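/- **Theorem.** Let $n\ge 2$ and let $F_n$ be the free group on $x_1,\dots,x_n$. Let $\tilde A_{n-1}$ be the affine braid group on $n$ strands: it has generators $\sigma_1,\dots,\sigma_n$, with indices modulo $n$, and, for $n\ge 3$, the relations $\sigma_i\sigma_{i+1}\sigma_i=\sigma_{i+1}\sigma_i\sigma_{i+1}$ for all $i$ and $\sigma_i\sigma_j=\sigma_j\sigma_i$ for $j\ne i,\,i\pm1$; for $n=2$ it is the free group on $\sigma_1,\sigma_2$ (no relations). Let $\rho_{\mathrm{Aff}}:\tilde A_{n-1}\to\operatorname{Aut}F_n$ be the representation induced by the action of the braid group of the necklace, that is, the homomorphism for which $\rho_{\mathrm{Aff}}(\sigma_i)$ is the automorphism $$x_i\mapsto x_i\,x_{i+1}\,x_i^{-1},\qquad x_{i+1}\mapsto x_i,\qquad x_j\mapsto x_j\quad (j\ne i,\,i+1)$$ (indices modulo $n$). Then: 1. $\rho_{\mathrm{Aff}}$ is faithful, i.e. injective. 2. An automorphism $\phi\in\operatorname{Aut}F_n$ belongs to $\rho_{\mathrm{Aff}}(\tilde A_{n-1})$ if and only if both of the following hold: * there are $w_1,\dots,w_n\in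 F_n$ and a permutation $\pi$ of $\{1,\dots,n\}$ with $\phi(x_i)=w_i\,x_{\pi(i)}\,w_i^{-1}$ for all $i$; * there is $w\in F_n$ of algebraic length $\ell(w)=0$ with $\phi(x_1x_2\cdots x_n)=w\,x_1x_2\cdots x_n\,w^{-1}$. Here $\ell:F_n\to\mathbb Z$ is the homomorphism with $\ell(x_i)=1$ for all $i$. -/

import Mathlib

namespace AffineBraid

variable {α : Type*}

/-- The endomorphism of the free group with `x_a ↦ x_a x_b x_a⁻¹`, `x_b ↦ x_a`, and
`x_j ↦ x_j` for `j ≠ a, b`. -/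
def braidHom [DecidableEq α] (a b : α) : FreeGroup α →* FreeGroup α :=
  FreeGroup.lift fun j =>
    if j = a then FreeGroup.of a * FreeGroup.of b * (FreeGroup.of a)⁻¹
    else if j = b then FreeGroup.of a
    else FreeGroup.of j

/-- The inverse of `braidHom a b`: `x_a ↦ x_b`, `x_b ↦ x_b⁻¹ x_a x_b`, and
`x_j ↦ x_j` for `j ≠ a, b`. -/
def braidInvHom [DecidableEq α] (a b : α) : FreeGroup α →* FreeGroup α :=
  FreeGroup.lift fun j =>
    if j = a then FreeGroup.of b
    else if j = b then (FreeGroup.of b)⁻¹ * FreeGroup.of a * FreeGroup.of b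
    else FreeGroup.of j

/-- The automorphism of the free group with `x_a ↦ x_a x_b x_a⁻¹`, `x_b ↦ x_a`, and
`x_j ↦ x_j` for `j ≠ a, b`. -/
def braidAut [DecidableEq α] (a b : α) (hab : a ≠ b) : MulAut (FreeGroup α) :=
  MonoidHom.toMulEquiv (braidHom a b) (braidInvHom a b)
    (by
      ext j
      by_cases h1 : j = a
      · subst h1; simp [braidHom, braidInvHom, hab.symm, mul_assoc]
      · by_cases h2 : j = b
        · subst h2; simp [braidHom, braidInvHom, hab.symm]
        · simp [braidHom, braidInvHom, h1, h2])
    (by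
      ext j
      by_cases h1 : j = a
      · subst h1; simp [braidHom, braidInvHom, hab.symm]
      · by_cases h2 : j = b
        · subst h2; simp [braidHom, braidInvHom, hab.symm, mul_assoc]
        · simp [braidHom, braidInvHom, h1, h2])

theorem braidAut_of [DecidableEq α] (a b : α) (hab : a ≠ b) (j : α) :
    braidAut a b hab (FreeGroup.of j) =
      if j = a then FreeGroup.of a * FreeGroup.of b * (FreeGroup.of a)⁻¹
      else if j = b then FreeGroup.of a
      else FreeGroup.of j := by
  simp [braidAut, braidHom]

theorem mulAut_ext_of {f g : MulAut (FreeGroup α)}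
    (h : ∀ j, f (FreeGroup.of j) = g (FreeGroup.of j)) : f = g := by
  apply MulEquiv.toMonoidHom_injective
  ext j
  exact h j

theorem braidAut_braid [DecidableEq α] (a b c : α) (hab : a ≠ b) (hbc : b ≠ c) (hac : a ≠ c) :
    braidAut a b hab * braidAut b c hbc * braidAut a b hab =
      braidAut b c hbc * braidAut a b hab * braidAut b c hbc := by
  apply mulAut_ext_of
  intro j
  by_cases h1 : j = a
  · subst h1
    simp [MulAut.mul_apply, braidAut_of, hab, hab.symm, hbc.symm, hac, hac.symm, mul_assoc]
  · by_cases h2 : j = b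
    · subst h2
      simp [MulAut.mul_apply, braidAut_of, hab, hab.symm, hbc.symm, hac, hac.symm, mul_assoc]
    · by_cases h3 : j = c
      · subst h3
        simp [MulAut.mul_apply, braidAut_of, hab, hab.symm, hbc.symm, hac, hac.symm, mul_assoc]
      · simp [MulAut.mul_apply, braidAut_of, h1, h2, h3]

theorem braidAut_comm [DecidableEq α] (a b c d : α) (hab : a ≠ b) (hcd : c ≠ d)
    (hac : a ≠ c) (had : a ≠ d) (hbc : b ≠ c) (hbd : b ≠ d) :
    braidAut a b hab * braidAut c d hcd = braidAut c d hcd * braidAut a b hab := by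
  apply mulAut_ext_of
  intro j
  by_cases h1 : j = a
  · subst h1; simp [MulAut.mul_apply, braidAut_of, hac, had, hbc, hbd]
  · by_cases h2 : j = b
    · subst h2; simp [MulAut.mul_apply, braidAut_of, hac, had, hab.symm, hbc, hbd]
    · by_cases h3 : j = c
      · subst h3; simp [MulAut.mul_apply, braidAut_of, hac.symm, had.symm, hbc.symm, hbd.symm]
      · by_cases h4 : j = d
        · subst h4
          simp [MulAut.mul_apply, braidAut_of, hac.symm, had.symm, hbc.symm, hbd.symm, hcd.symm]
        · simp [MulAut.mul_apply, braidAut_of, h1, h2, h3, h4]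

end AffineBraid

/-- The cyclic successor `i ↦ i + 1` modulo `n`; the indices `1, …, n` are represented by
`Fin n`, that is, by `0, …, n - 1`. -/
def cycSucc {n : ℕ} (i : Fin n) : Fin n :=
  ⟨(i.val + 1) % n, Nat.mod_lt _ i.pos⟩

theorem ne_cycSucc {n : ℕ} (hn : 2 ≤ n) (i : Fin n) : i ≠ cycSucc i := by
  obtain ⟨i, hi⟩ := i
  simp only [cycSucc, ne_eq, Fin.mk.injEq]
  rcases Nat.lt_or_ge (i + 1) n with h | h
  · rw [Nat.mod_eq_of_lt h]; omega
  · have h2 : i + 1 = n := by omega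
    rw [h2, Nat.mod_self]; omega

theorem cycSucc_injective {n : ℕ} : Function.Injective (cycSucc (n := n)) := by
  rintro ⟨i, hi⟩ ⟨j, hj⟩ h
  simp only [cycSucc, Fin.mk.injEq] at h ⊢
  rcases Nat.lt_or_ge (i + 1) n with h1 | h1 <;> rcases Nat.lt_or_ge (j + 1) n with h2 | h2
  · rw [Nat.mod_eq_of_lt h1, Nat.mod_eq_of_lt h2] at h; omega
  · have h3 : j + 1 = n := by omega
    rw [Nat.mod_eq_of_lt h1, h3, Nat.mod_self] at h; omega
  · have h3 : i + 1 = n := by omega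
    rw [Nat.mod_eq_of_lt h2, h3, Nat.mod_self] at h; omega
  · omega

theorem ne_cycSucc_cycSucc {n : ℕ} (hn : 3 ≤ n) (i : Fin n) : i ≠ cycSucc (cycSucc i) := by
  obtain ⟨i, hi⟩ := i
  simp only [cycSucc, ne_eq, Fin.mk.injEq]
  rcases Nat.lt_or_ge (i + 1) n with h | h
  · rw [Nat.mod_eq_of_lt h]
    rcases Nat.lt_or_ge (i + 1 + 1) n with h' | h'
    · rw [Nat.mod_eq_of_lt h']; omega
    · have h2 : i + 1 + 1 = n := by omega
      rw [h2, Nat.mod_self]; omega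
  · have h2 : i + 1 = n := by omega
    rw [h2, Nat.mod_self, Nat.mod_eq_of_lt (by omega)]; omega

/-- The defining relators of the affine braid group on `n` strands, with generators
`σ_1, …, σ_n` indexed cyclically: the braid relation between cyclically consecutive
generators, and commutation of the pairs that are not cyclically consecutive. For `n = 2`
the two generators satisfy no relation (the label of the Coxeter diagram of affine type `A_1`
is infinite). -/
inductive AffineBraidRelator (n : ℕ) : FreeGroup (Fin n) → Prop
  | braid (hn : 3 ≤ n) (i : Fin n) :
      AffineBraidRelator n
        ((FreeGroup.of i * FreeGroup.of (cycSucc i) * FreeGroup.of i) *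
          (FreeGroup.of (cycSucc i) * FreeGroup.of i * FreeGroup.of (cycSucc i))⁻¹)
  | comm (i j : Fin n) (hij : i ≠ j) (h1 : j ≠ cycSucc i) (h2 : i ≠ cycSucc j) :
      AffineBraidRelator n
        ((FreeGroup.of i * FreeGroup.of j) * (FreeGroup.of j * FreeGroup.of i)⁻¹)

/-- The affine braid group on `n` strands (the Artin group of affine type `A_{n-1}`). -/
abbrev AffineBraidGroup (n : ℕ) : Type :=
  PresentedGroup {r : FreeGroup (Fin n) | AffineBraidRelator n r}

/-- The automorphism of the free group `F_n` assigned to the generator `σ_i`, with indices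
modulo `n`: `x_i ↦ x_i x_{i+1} x_i⁻¹`, `x_{i+1} ↦ x_i`, and `x_j ↦ x_j` for `j ≠ i, i + 1`. -/
def sigmaAut {n : ℕ} (hn : 2 ≤ n) (i : Fin n) : MulAut (FreeGroup (Fin n)) :=
  AffineBraid.braidAut i (cycSucc i) (ne_cycSucc hn i)

theorem sigmaAut_relator {n : ℕ} (hn : 2 ≤ n) (r : FreeGroup (Fin n))
    (hr : AffineBraidRelator n r) : FreeGroup.lift (sigmaAut hn) r = 1 := by
  cases hr with
  | braid h3 i =>
    simp only [map_mul, map_inv, FreeGroup.lift_apply_of]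
    rw [mul_inv_eq_one]
    exact AffineBraid.braidAut_braid _ _ _ _ _ (ne_cycSucc_cycSucc h3 i)
  | comm i j hij h1 h2 =>
    simp only [map_mul, map_inv, FreeGroup.lift_apply_of]
    rw [mul_inv_eq_one]
    exact AffineBraid.braidAut_comm _ _ _ _ _ _ hij h2 h1.symm
      (fun h => hij (cycSucc_injective h))

/-- The representation of the affine braid group on `n` strands in `Aut F_n`, sending the
generator `σ_i` to `sigmaAut hn i`; the product of `MulAut` is composition, `(f * g) x = f (g x)`. -/
def rhoAff {n : ℕ} (hn : 2 ≤ n) : AffineBraidGroup n →* MulAut (FreeGroup (Fin n)) :=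
  PresentedGroup.toGroup (f := sigmaAut hn) (sigmaAut_relator hn)

/-- The algebraic length of a word: the sum of its exponents, that is, the homomorphism
`F_n → ℤ` with `x_i ↦ 1` for every `i`. -/
def algLength {n : ℕ} (w : FreeGroup (Fin n)) : ℤ :=
  Multiplicative.toAdd
    (FreeGroup.lift (fun _ : Fin n => Multiplicative.ofAdd (1 : ℤ)) w)

/-- The product `x_1 x_2 ⋯ x_n` in the free group. -/
def prodGenerators (n : ℕ) : FreeGroup (Fin n) :=
  (List.ofFn fun i : Fin n => FreeGroup.of i).prod

namespace AffineBraid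

open FreeGroup hiding map_mul map_inv map_one

/-! ### Reduced words and lengths of conjugates of generators -/

section Words

variable {α : Type*}

/-! Write `φ (x_i) = U_i x_{π i} U_i⁻¹` with `U_i` as short as possible, and measure `φ` by the
total length of these images. Composing on the right with `σ_i^{±1}` swaps two cyclically
neighbouring images and conjugates one of them by the other. The total length drops strictly if one
conjugator begins with the other followed by the cancelling letter (`IsDescent`), and otherwise
rises strictly.

Image. If nothing can be shortened, no cancellation occurs in the cyclic word obtained by
multiplying the images, so this word is cyclically reduced. It is conjugate to `x_1 ⋯ x_n`, hence a
rotation of it. Comparing lengths makes all `U_i` equal and then empty, and the condition on the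
algebraic length excludes a nontrivial rotation (`eq_generators_of_no_descent`). Thus every `φ ≠ 1`
satisfying the two conditions has a descent, and descending to the identity writes `φ` as a word in
the `σ_i`.

Faithfulness. Pull the length back to a height on the affine braid group. Each element descends to
some element of the kernel. If this end is unique, then `g` and `g σ_i^{±1}` have the same end, so
every end is that of `1`; a kernel element, being its own end, is trivial. Uniqueness is a
confluence argument: two descents from `g` must be joined by a path of lower elements. Commutation
or a braid relation supplies the path (`joinedBelow_of_descents`), except when `U_{i+1}` followed by
`x` begins `U_i` while `U_{i+1}` followed by `x⁻¹` begins `U_{i+2}`, with `x = x_{π (i+1)}`.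

This configuration is excluded geometrically (`not_isDescent_false_and_true`). The free group acts
on the line, the universal cover of a circle, with generators pairing the sides of an ideal polygon.
Each braid carries the polygon to another one whose sides are paired by the images of the
generators; the forbidden prefixes would put its vertices in sectors incompatible with the pairing.
-/

theorem isReduced_append {L M : List (α × Bool)} :
    IsReduced (L ++ M) ↔ IsReduced L ∧ IsReduced M ∧
      ∀ a ∈ L.getLast?, ∀ b ∈ M.head?, a.1 = b.1 → a.2 = b.2 :=
  List.isChain_append

theorem getLast?_invRev (L : List (α × Bool)) :
    (invRev L).getLast? = L.head?.map fun a => (a.1, !a.2) := by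
  cases L <;> simp [invRev]

theorem head?_invRev (L : List (α × Bool)) :
    (invRev L).head? = L.getLast?.map fun a => (a.1, !a.2) := by
  simp [invRev, List.getLast?_map]

theorem isReduced_invRev {L : List (α × Bool)} (h : IsReduced L) : IsReduced (invRev L) := by
  classical
  apply IsReduced.of_reduce_eq
  rw [reduce_invRev, h.reduce_eq]

/-- Two lists have a longest common prefix. -/
theorem exists_common_prefix (U V : List α) :
    ∃ p u v, U = p ++ u ∧ V = p ++ v ∧ ∀ a ∈ u.head?, ∀ b ∈ v.head?, a ≠ b := by
  classical
  induction U generalizing V with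
  | nil => exact ⟨[], [], V, by simp⟩
  | cons a U ih =>
    cases V with
    | nil => exact ⟨[], a :: U, [], by simp⟩
    | cons b V =>
      by_cases h : a = b
      · obtain ⟨p, u, v, h1, h2, h3⟩ := ih V
        exact ⟨a :: p, u, v, by simp [h1], by simp [h2, h], h3⟩
      · exact ⟨[], a :: U, b :: V, by simp [h]⟩

theorem isReduced_invRev_append {u v : List (α × Bool)} (hu : IsReduced u) (hv : IsReduced v)
    (h : ∀ a ∈ u.head?, ∀ b ∈ v.head?, a ≠ b) : IsReduced (invRev u ++ v) := by
  refine isReduced_append.2 ⟨isReduced_invRev hu, hv, ?_⟩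
  intro a ha b hb hab
  rw [getLast?_invRev] at ha
  obtain ⟨c, hc, rfl⟩ : ∃ c, c ∈ u.head? ∧ (c.1, !c.2) = a := by simpa using ha
  have := h c hc b hb
  simp only at hab ⊢
  by_contra h2
  exact this (Prod.ext hab (by revert h2; cases c.2 <;> cases b.2 <;> simp))

/-- The word `U` is reduced and stays reduced when followed by a power of `y`: it is the shortest
representative of its right coset of the powers of `y`. -/
def IsTight (U : List (α × Bool)) (y : α) : Prop :=
  IsReduced U ∧ ∀ l ∈ U.getLast?, l.1 ≠ y

theorem IsTight.append_singleton {U : List (α × Bool)} {y : α} (h : IsTight U y) (b : Bool) :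
    IsReduced (U ++ [(y, b)]) := by
  refine isReduced_append.2 ⟨h.1, IsReduced.singleton, ?_⟩
  intro a ha c hc hac
  obtain rfl : (y, b) = c := by simpa using hc
  exact absurd hac (h.2 a ha)

theorem IsTight.cons_invRev {U : List (α × Bool)} {y : α} (h : IsTight U y) (b : Bool) :
    IsReduced ((y, b) :: invRev U) := by
  have := isReduced_invRev (h.append_singleton (!b))
  simpa [invRev] using this

theorem IsTight.isReduced_conj {U : List (α × Bool)} {y : α} (h : IsTight U y) (b : Bool) :
    IsReduced (U ++ [(y, b)] ++ invRev U) :=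
  IsReduced.append_overlap (h.append_singleton b) (by simpa using h.cons_invRev b) (by simp)

theorem mk_conj_of (U : List (α × Bool)) (y : α) :
    mk U * of y * (mk U)⁻¹ = mk (U ++ [(y, true)] ++ invRev U) := by
  simp [of, inv_mk, mul_mk]

theorem mk_concat_conj_of (U : List (α × Bool)) (y : α) (b : Bool) :
    mk (U ++ [(y, b)]) * of y * (mk (U ++ [(y, b)]))⁻¹ = mk U * of y * (mk U)⁻¹ := by
  have h : mk [(y, b)] * of y * (mk [(y, b)])⁻¹ = of y := by
    cases b
    · have : mk [(y, false)] = (of y)⁻¹ := by simp [of, inv_mk, invRev]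
      rw [this]; group
    · have : mk [(y, true)] = of y := rfl
      rw [this]; group
  rw [← mul_mk, mul_inv_rev]
  calc _ = mk U * (mk [(y, b)] * of y * (mk [(y, b)])⁻¹) * (mk U)⁻¹ := by group
    _ = _ := by rw [h]

variable [DecidableEq α]

theorem norm_conj_le (U : List (α × Bool)) (y : α) :
    norm (mk U * of y * (mk U)⁻¹) ≤ 2 * U.length + 1 := by
  rw [mk_conj_of]
  refine norm_mk_le.trans ?_
  simp; omega

theorem IsTight.norm_conj {U : List (α × Bool)} {y : α} (h : IsTight U y) :
    norm (mk U * of y * (mk U)⁻¹) = 2 * U.length + 1 := by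
  rw [mk_conj_of, FreeGroup.norm, toWord_mk, (h.isReduced_conj true).reduce_eq]
  simp; omega

/-- Trailing letters `y^{±1}` commute with `y` and can be stripped from the conjugator. Stripping
stops at the last letter different from `y`, so every prefix ending in such a letter survives; this
gives lower bounds on norms. -/
theorem exists_isTight_of_isReduced {U : List (α × Bool)} (hU : IsReduced U) (y : α) :
    ∃ V, IsTight V y ∧ V <+: U ∧
      (∀ Z a b, (a : α) ≠ y → Z ++ [(a, (b : Bool))] <+: U → Z ++ [(a, b)] <+: V) ∧
      mk U * of y * (mk U)⁻¹ = mk V * of y * (mk V)⁻¹ := by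
  induction U using List.reverseRecOn with
  | nil => exact ⟨[], ⟨IsReduced.nil, by simp⟩, by simp, by simp, rfl⟩
  | append_singleton U l ih =>
    by_cases h : l.1 = y
    · obtain ⟨V, h1, h2, h3, h4⟩ := ih (hU.infix (List.prefix_append U [l]).isInfix)
      refine ⟨V, h1, h2.trans (List.prefix_append U [l]), ?_, ?_⟩
      · intro Z a b ha hZ
        refine h3 Z a b ha ?_
        rcases List.prefix_concat_iff.1 hZ with h5 | h5
        · have := (List.append_inj' h5 rfl).2
          simp only [List.cons.injEq, and_true] at this
          rw [← this] at h
          exact absurd h ha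
        · exact h5
      · rw [← h4]
        obtain ⟨c, b⟩ := l
        obtain rfl : c = y := h
        exact mk_concat_conj_of U c b
    · exact ⟨U ++ [l], ⟨hU, by simpa using h⟩, List.prefix_rfl, fun _ _ _ _ h => h, rfl⟩

theorem exists_isTight (g : FreeGroup α) (y : α) :
    ∃ U, IsTight U y ∧ g * of y * g⁻¹ = mk U * of y * (mk U)⁻¹ := by
  obtain ⟨V, h1, _, _, h4⟩ := exists_isTight_of_isReduced (isReduced_toWord (x := g)) y
  exact ⟨V, h1, by simpa [mk_toWord] using h4⟩

theorem lt_norm_conj {U Z : List (α × Bool)} {a y : α} {b : Bool} (hU : IsReduced U) (hay : a ≠ y)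
    (hZ : Z ++ [(a, b)] <+: U) : 2 * Z.length + 1 < norm (mk U * of y * (mk U)⁻¹) := by
  obtain ⟨V, h1, _, h3, h4⟩ := exists_isTight_of_isReduced hU y
  rw [h4, h1.norm_conj]
  have := (h3 Z a b hay hZ).length_le
  simp at this; omega

/-- Conjugating `V y V⁻¹` by `U x^{±1} U⁻¹` lengthens it unless `V` begins with `U x^{∓1}`. -/
theorem IsTight.lt_norm_conj {U V : List (α × Bool)} {x y : α} (hU : IsTight U x)
    (hV : IsTight V y) (hxy : x ≠ y) (e : Bool) (h : ¬ U ++ [(x, !e)] <+: V) :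
    2 * V.length + 1 <
      norm (mk (U ++ [(x, e)] ++ invRev U ++ V) * of y * (mk (U ++ [(x, e)] ++ invRev U ++ V))⁻¹) := by
  obtain ⟨p, u, v, hp, hq, hd⟩ := exists_common_prefix U V
  have hmk : mk (U ++ [(x, e)] ++ invRev U ++ V) = mk (U ++ [(x, e)] ++ (invRev u ++ v)) := by
    nth_rw 2 [hp]
    rw [hq]
    simp only [← mul_mk, invRev_append, ← inv_mk]
    group
  rw [hmk]
  have hu : IsReduced u := hU.1.infix (by rw [hp]; exact (List.suffix_append p u).isInfix)
  have hv : IsReduced v := hV.1.infix (by rw [hq]; exact (List.suffix_append p v).isInfix)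
  -- Only one junction can cancel: if `u` is empty, `x^e` meets the first letter of `v`, and a
  -- cancellation there is exactly the excluded prefix.
  have hr : IsReduced (U ++ [(x, e)] ++ (invRev u ++ v)) := by
    by_cases hu0 : u = []
    · subst hu0
      simp only [List.append_nil] at hp
      subst hp
      refine isReduced_append.2 ⟨hU.append_singleton e, by simpa using hv, ?_⟩
      intro a ha b hb hab
      obtain rfl : (x, e) = a := by simpa using ha
      simp only at hab ⊢
      by_contra h2
      apply h
      have hb' : b ∈ v.head? := by simpa using hb
      obtain ⟨w, rfl⟩ : ∃ w, v = b :: w := by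
        cases v with
        | nil => simp at hb'
        | cons c w => exact ⟨w, by simp at hb'; simp [hb']⟩
      have : b = (x, !e) := Prod.ext hab.symm (by revert h2; cases e <;> cases b.2 <;> simp)
      rw [hq, this]
      exact ⟨w, by simp⟩
    · have h1 : IsReduced ((U ++ [(x, e)]) ++ invRev u) := by
        refine IsReduced.append_overlap (hU.append_singleton e) ?_ (by simp)
        have := hU.cons_invRev e
        rw [hp, invRev_append] at this
        exact this.infix (List.prefix_append _ (invRev p)).isInfix
      rw [← List.append_assoc]
      exact IsReduced.append_overlap h1 (isReduced_invRev_append hu hv hd)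
        (by intro h0; exact hu0 (by simpa [invRev] using h0))
  -- If `v` is empty, the new conjugator may end in letters `y^{±1}`, but the letter `x^e ≠ y^{±1}`
  -- after `U` survives and `V` is no longer than `U`. Otherwise the conjugator ends like `V`, so it
  -- is tight and its length can be read off.
  by_cases hv0 : v = []
  · have h2 := AffineBraid.lt_norm_conj hr hxy (List.prefix_append (U ++ [(x, e)]) _)
    have : V.length ≤ U.length := by rw [hp, hq, hv0]; simp
    omega
  · have h2 : IsTight (U ++ [(x, e)] ++ (invRev u ++ v)) y := by
      refine ⟨hr, ?_⟩
      have := hV.2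
      rw [hq] at this
      rw [← List.append_assoc, List.getLast?_append_of_ne_nil _ hv0]
      rwa [List.getLast?_append_of_ne_nil _ hv0] at this
    rw [h2.norm_conj, hp, hq]
    simp; omega

end Words

end AffineBraid

namespace AffineBraid

open FreeGroup hiding map_mul map_inv map_one

/-! ### Conjugates of positive words and cyclic rotations -/

section Rotation

variable {n : ℕ}

@[simp] theorem algLength_mul (g h : FreeGroup (Fin n)) :
    algLength (g * h) = algLength g + algLength h := by simp [algLength]

@[simp] theorem algLength_inv (g : FreeGroup (Fin n)) : algLength g⁻¹ = -algLength g := by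
  simp [algLength]

@[simp] theorem algLength_of (i : Fin n) : algLength (of i) = 1 := by simp [algLength]

@[simp] theorem algLength_one : algLength (1 : FreeGroup (Fin n)) = 0 := by simp [algLength]

/-- The positive word spelled by a list of generators. -/
abbrev posWord {α : Type*} (W : List α) : List (α × Bool) := W.map fun a => (a, true)

theorem isReduced_posWord {α : Type*} (W : List α) : IsReduced (posWord W) := by
  induction W with
  | nil => exact IsReduced.nil
  | cons a W ih =>
    cases W with
    | nil => exact IsReduced.singleton
    | cons b W => exact isReduced_cons_cons.2 ⟨fun _ => rfl, ih⟩

/-- If a positive word is conjugate to a cyclically reduced word, the latter is a cyclic rotation of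
the former, and the length of the conjugator is determined modulo the length of the word. -/
theorem eq_rotate_of_conj {W : List (Fin n)} (hW : W ≠ []) {W' : List (Fin n × Bool)}
    (hW' : IsCyclicallyReduced W') {g : FreeGroup (Fin n)}
    (h : g * mk (posWord W) * g⁻¹ = mk W') :
    ∃ k : ℕ, W' = posWord (W.rotate k) ∧ (W.length : ℤ) ∣ algLength g + k := by
  obtain ⟨U, hU, rfl⟩ : ∃ U, IsReduced U ∧ mk U = g := ⟨g.toWord, isReduced_toWord, mk_toWord⟩
  induction U using List.reverseRecOn generalizing W with
  | nil =>
    refine ⟨0, ?_, by simp [← one_eq_mk]⟩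
    have h1 : mk (posWord W) = mk W' := by simpa [← one_eq_mk] using h
    have h2 := reduce.sound h1
    rw [(isReduced_posWord W).reduce_eq, hW'.isReduced.reduce_eq] at h2
    simp [← h2]
  | append_singleton U l ih =>
    have hU' : IsReduced U := hU.infix (List.prefix_append U [l]).isInfix
    -- The last letter of the conjugator either cancels the first letter of `W`, or cancels against
    -- its last letter on the other side, or does not cancel at all. The first two cases rotate `W`
    -- and shorten the conjugator.
    by_cases h1 : ∃ W₁, W = l.1 :: W₁ ∧ l.2 = false
    · obtain ⟨W₁, rfl, hl⟩ := h1
      obtain ⟨a, b⟩ := l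
      simp only at hl h hU
      subst hl
      have hmk : mk (U ++ [(a, false)]) = mk U * (of a)⁻¹ := by
        simp [of, inv_mk, mul_mk, invRev]
      obtain ⟨k, hk, hd⟩ := ih (W := W₁ ++ [a]) (by simp) hU' (by
        rw [← h, hmk]
        have h1 : mk (posWord (W₁ ++ [a])) = mk (posWord W₁) * of a := by
          simp [of, mul_mk]
        have h2 : mk (posWord (a :: W₁)) = of a * mk (posWord W₁) := by
          simp [of, mul_mk]
        rw [h1, h2]; group)
      refine ⟨k + 1, by rw [hk, List.rotate_cons_succ], ?_⟩
      rw [hmk]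
      have : ((a :: W₁).length : ℤ) = ((W₁ ++ [a]).length : ℤ) := by simp
      rw [this]
      convert hd using 1
      simp; ring
    by_cases h2 : ∃ W₁, W = W₁ ++ [l.1] ∧ l.2 = true
    · obtain ⟨W₁, rfl, hl⟩ := h2
      obtain ⟨a, b⟩ := l
      simp only at hl h hU
      subst hl
      have hmk : mk (U ++ [(a, true)]) = mk U * of a := by simp [of, mul_mk]
      obtain ⟨k, hk, hd⟩ := ih (W := a :: W₁) (by simp) hU' (by
        rw [← h, hmk]
        have h1 : mk (posWord (W₁ ++ [a])) = mk (posWord W₁) * of a := by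
          simp [of, mul_mk]
        have h2 : mk (posWord (a :: W₁)) = of a * mk (posWord W₁) := by
          simp [of, mul_mk]
        rw [h1, h2]; group)
      -- Rotating backwards by one is rotating forwards by `W.length - 1`.
      refine ⟨k + W₁.length, ?_, ?_⟩
      · rw [hk]
        congr 1
        rw [Nat.add_comm, ← List.rotate_rotate, List.rotate_append_length_eq]
        rfl
      · rw [hmk]
        have : ((W₁ ++ [a]).length : ℤ) = ((a :: W₁).length : ℤ) := by simp
        rw [this]
        have h3 : algLength (mk U * of a) + ((k + W₁.length : ℕ) : ℤ)
            = algLength (mk U) + k + ((a :: W₁).length : ℤ) := by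
          simp; ring
        rw [h3]
        exact dvd_add hd dvd_rfl
    exfalso
    have hr1 : IsReduced ((U ++ [l]) ++ posWord W) := by
      refine isReduced_append.2 ⟨hU, isReduced_posWord W, ?_⟩
      intro a ha b hb hab
      obtain rfl : l = a := by simpa using ha
      cases W with
      | nil => exact absurd rfl hW
      | cons c W =>
        obtain rfl : (c, true) = b := by simpa using hb
        by_contra h3
        exact h1 ⟨W, by simp only at hab; rw [hab], by simpa using h3⟩
    have hr2 : IsReduced (posWord W ++ invRev (U ++ [l])) := by
      refine isReduced_append.2 ⟨isReduced_posWord W, isReduced_invRev hU, ?_⟩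
      intro a ha b hb hab
      rw [head?_invRev] at hb
      obtain rfl : (l.1, !l.2) = b := by simpa using hb
      obtain ⟨W₁, c, rfl⟩ : ∃ W₁ c, W = W₁ ++ [c] :=
        ⟨W.dropLast, W.getLast hW, (List.dropLast_append_getLast hW).symm⟩
      obtain rfl : (c, true) = a := by simpa using ha
      simp only at hab ⊢
      by_contra h3
      exact h2 ⟨W₁, by rw [hab], by simpa using h3⟩
    have hr := IsReduced.append_overlap hr1 hr2 (by simpa using hW)
    rw [inv_mk, mul_mk, mul_mk] at h
    have h3 := reduce.sound h
    rw [hr.reduce_eq, hW'.isReduced.reduce_eq] at h3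
    -- Without cancellation the reduced word begins with a letter and ends with its inverse, so it
    -- is not cyclically reduced.
    have h4 := hW'.2
    rw [← h3, List.getLast?_append_of_ne_nil _ (by simp [invRev]), getLast?_invRev] at h4
    obtain ⟨c, V, hc⟩ : ∃ c V, U ++ [l] = c :: V := by
      cases U with
      | nil => exact ⟨_, _, rfl⟩
      | cons c V => exact ⟨c, V ++ [l], rfl⟩
    rw [hc] at h4
    have := h4 (c.1, !c.2) (by simp) c (by simp) rfl
    revert this
    cases c.2 <;> simp

end Rotation

/-- With `h i` the conjugator of the `i`-th factor, this redistributes a product of conjugates into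
blocks: a generator followed by the quotient of two consecutive conjugators. -/
theorem prod_ofFn_telescope {G : Type*} [Group G] (m : ℕ) (h A : ℕ → G) :
    (List.ofFn fun i : Fin m => (h i)⁻¹ * A i * h (i + 1)).prod =
      (h 0)⁻¹ * (List.ofFn fun i : Fin m => A i).prod * h m := by
  induction m with
  | zero => simp
  | succ m ih =>
    simp only [List.ofFn_succ', List.concat_eq_append, List.prod_append, List.prod_singleton,
      Fin.val_castSucc, Fin.val_last, ih]
    group

theorem eq_of_forall_cycSucc {n : ℕ} {β : Type*} {f : Fin n → β}
    (h : ∀ i, f (cycSucc i) = f i) (i j : Fin n) : f i = f j := by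
  have key : ∀ k (hk : k < n), f ⟨k, hk⟩ = f ⟨0, by omega⟩ := by
    intro k
    induction k with
    | zero => intro _; rfl
    | succ k ih =>
      intro hk
      rw [← ih (by omega), ← h ⟨k, by omega⟩]
      congr 1
      simp [cycSucc, Nat.mod_eq_of_lt hk]
  rw [key i.1 i.2, key j.1 j.2]

end AffineBraid

/-! ### Tuples of conjugates without descents -/

namespace AffineBraid

open FreeGroup hiding map_mul map_inv map_one

theorem prodGenerators_eq (n : ℕ) : prodGenerators n = mk (posWord (List.finRange n)) := by
  have : ∀ W : List (Fin n), (W.map of).prod = mk (posWord W) := by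
    intro W
    induction W with
    | nil => rfl
    | cons a W ih => rw [List.map_cons, List.prod_cons, ih, of, mul_mk]; rfl
  rw [prodGenerators, List.ofFn_eq_map, this]

theorem mk_flatten {α : Type*} (L : List (List (α × Bool))) :
    mk L.flatten = (L.map mk).prod := by
  induction L with
  | nil => rfl
  | cons a L ih => rw [List.flatten_cons, ← mul_mk, ih, List.map_cons, List.prod_cons]

theorem pref_of_head {β : Type*} {p v : List β} {x : β} (h : x ∈ v.head?) :
    p ++ [x] <+: p ++ v := by
  cases v with
  | nil => simp at h
  | cons c v =>
    obtain rfl : c = x := by simpa using h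
    exact ⟨v, by simp⟩

/-- A tuple of conjugates of the generators with cyclic product conjugate to `x_1 ⋯ x_n`, none of
which is shortened by a neighbour, is the tuple of generators. -/
theorem eq_generators_of_no_descent {n : ℕ} (hn : 0 < n) {U : Fin n → List (Fin n × Bool)}
    {π : Equiv.Perm (Fin n)} (hU : ∀ i, IsTight (U i) (π i)) {w : FreeGroup (Fin n)}
    (hw : algLength w = 0)
    (hprod : (List.ofFn fun i => mk (U i) * of (π i) * (mk (U i))⁻¹).prod =
      w * prodGenerators n * w⁻¹)
    (h1 : ∀ i, ¬ U i ++ [(π i, false)] <+: U (cycSucc i))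
    (h2 : ∀ i, ¬ U (cycSucc i) ++ [(π (cycSucc i), true)] <+: U i) :
    (∀ i, U i = []) ∧ ∀ i, π i = i := by
  choose p u v hp hq hd using fun i => exists_common_prefix (U i) (U (cycSucc i))
  have hu : ∀ i, IsReduced (u i) := fun i =>
    (hU i).1.infix (by rw [hp i]; exact (List.suffix_append (p i) (u i)).isInfix)
  have hv : ∀ i, IsReduced (v i) := fun i =>
    (hU (cycSucc i)).1.infix (by rw [hq i]; exact (List.suffix_append (p i) (v i)).isInfix)
  let c : Fin n → List (Fin n × Bool) := fun i => invRev (u i) ++ v i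
  have hc : ∀ i, IsReduced (c i) := fun i => isReduced_invRev_append (hu i) (hv i) (hd i)
  have hcmk : ∀ i, mk (c i) = (mk (U i))⁻¹ * mk (U (cycSucc i)) := by
    intro i
    rw [hp i, hq i, ← mul_mk, ← mul_mk, ← mul_mk, ← inv_mk]
    group
  -- no cancellation on the left of `c i`
  have hleft : ∀ i, ∀ b ∈ (c i).head?, (π i) = b.1 → true = b.2 := by
    intro i b hb hab
    by_cases hu0 : u i = []
    · simp only [c, hu0, invRev_empty, List.nil_append] at hb
      by_contra h3
      apply h1 i
      rw [hq i, show U i = p i by rw [hp i, hu0, List.append_nil]]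
      have : b = (π i, false) := Prod.ext hab.symm (by revert h3; cases b.2 <;> simp)
      exact pref_of_head (this ▸ hb)
    · have h3 := (hU i).cons_invRev true
      rw [hp i, invRev_append] at h3
      have h4 := (isReduced_append (L := [(π i, true)])).1 h3
      refine h4.2.2 (π i, true) (by simp) b ?_ hab
      change b ∈ (invRev (u i) ++ invRev (p i)).head?
      have hne : invRev (u i) ≠ [] := by simpa [invRev] using hu0
      rw [List.head?_append_of_ne_nil _ hne]
      simpa only [c, List.head?_append_of_ne_nil _ hne] using hb
  have hright : ∀ i, ∀ a ∈ (c i).getLast?, a.1 = π (cycSucc i) → a.2 = true := by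
    intro i a ha hab
    by_cases hv0 : v i = []
    · simp only [c, hv0, List.append_nil, getLast?_invRev] at ha
      obtain ⟨b, hb, rfl⟩ : ∃ b, b ∈ (u i).head? ∧ (b.1, !b.2) = a := by simpa using ha
      by_contra h3
      apply h2 i
      rw [show U (cycSucc i) = p i by rw [hq i, hv0, List.append_nil], hp i]
      have : b = (π (cycSucc i), true) :=
        Prod.ext hab (by revert h3; cases b.2 <;> simp)
      exact pref_of_head (this ▸ hb)
    · have h3 := (hU (cycSucc i)).append_singleton true
      rw [hq i] at h3
      have h4 := (isReduced_append (M := [(π (cycSucc i), true)])).1 h3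
      refine h4.2.2 a ?_ (π (cycSucc i), true) (by simp) hab
      rw [List.getLast?_append_of_ne_nil _ hv0]
      simpa only [c, List.getLast?_append_of_ne_nil _ hv0] using ha
  -- `B i` spells `x_{π i} U_i⁻¹ U_{i+1}`; the absence of descents is what prevents cancellation at
  -- the ends of `c i`.
  let B : Fin n → List (Fin n × Bool) := fun i => (π i, true) :: c i
  have hB : ∀ i, IsReduced (B i) := fun i =>
    (isReduced_append (L := [(π i, true)])).2 ⟨IsReduced.singleton, hc i, by
      intro a ha b hb
      obtain rfl : (π i, true) = a := by simpa using ha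
      exact hleft i b hb⟩
  have hBB : ∀ i, ∀ a ∈ (B i).getLast?, ∀ b ∈ (B (cycSucc i)).head?, a.1 = b.1 → a.2 = b.2 := by
    intro i a ha b hb hab
    obtain rfl : (π (cycSucc i), true) = b := by simpa [B] using hb
    by_cases hc0 : c i = []
    · simp only [B, hc0] at ha
      obtain rfl : (π i, true) = a := by simpa using ha
      rfl
    · refine hright i a ?_ hab
      have : B i = [(π i, true)] ++ c i := rfl
      rwa [this, List.getLast?_append_of_ne_nil _ hc0] at ha
  have hWred : IsReduced (List.ofFn B).flatten := by
    refine (List.isChain_flatten (by simp [List.mem_ofFn, B])).2 ⟨?_, ?_⟩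
    · intro l hl
      obtain ⟨i, rfl⟩ := List.mem_ofFn.1 hl
      exact hB i
    · refine List.isChain_ofFn.2 ?_
      intro i hi
      have : (⟨i + 1, hi⟩ : Fin n) = cycSucc ⟨i, by omega⟩ := by
        simp [cycSucc, Nat.mod_eq_of_lt hi]
      rw [this]
      exact hBB _
  obtain ⟨m, rfl⟩ : ∃ m, n = m + 1 := ⟨n - 1, by omega⟩
  have hcyc : IsCyclicallyReduced (List.ofFn B).flatten := by
    refine ⟨hWred, ?_⟩
    intro a ha b hb
    have h3 : cycSucc (Fin.last m) = 0 := by simp [cycSucc]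
    refine hBB (Fin.last m) a ?_ b ?_
    · rw [List.ofFn_succ', List.concat_eq_append, List.flatten_append, List.flatten_singleton,
        List.getLast?_append_of_ne_nil _ (by simp [B])] at ha
      exact ha
    · rw [h3]
      rw [List.ofFn_succ, List.flatten_cons, List.head?_append_of_ne_nil _ (by simp [B])] at hb
      exact hb
  have hmk : mk (List.ofFn B).flatten =
      (mk (U 0))⁻¹ * (w * prodGenerators (m + 1) * w⁻¹) * mk (U 0) := by
    have h4 := prod_ofFn_telescope (m + 1)
      (fun k => mk (U ⟨k % (m + 1), Nat.mod_lt _ (by omega)⟩))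
      (fun k => mk (U ⟨k % (m + 1), Nat.mod_lt _ (by omega)⟩) *
        of (π ⟨k % (m + 1), Nat.mod_lt _ (by omega)⟩) *
        (mk (U ⟨k % (m + 1), Nat.mod_lt _ (by omega)⟩))⁻¹)
    have h5 : ∀ i : Fin (m + 1), (⟨i.1 % (m + 1), Nat.mod_lt _ (by omega)⟩ : Fin (m + 1)) = i :=
      fun i => by ext; exact Nat.mod_eq_of_lt i.2
    have h6 : ∀ i : Fin (m + 1),
        (⟨(i.1 + 1) % (m + 1), Nat.mod_lt _ (by omega)⟩ : Fin (m + 1)) = cycSucc i := fun i => rfl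
    simp only [h5, h6] at h4
    have h7 : (⟨0 % (m + 1), Nat.mod_lt _ (by omega)⟩ : Fin (m + 1)) = 0 := by simp
    have h8 : (⟨(m + 1) % (m + 1), Nat.mod_lt _ (by omega)⟩ : Fin (m + 1)) = 0 := by
      simp
    rw [h7, h8, hprod] at h4
    rw [← h4, mk_flatten, List.map_ofFn]
    congr 2
    funext i
    simp only [Function.comp_apply, B]
    rw [show ((π i, true) :: c i) = [(π i, true)] ++ c i from rfl, ← mul_mk, hcmk i, of]
    group
  obtain ⟨k, hk, hdvd⟩ := eq_rotate_of_conj (W := List.finRange (m + 1)) (by simp) hcyc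
    (g := (mk (U 0))⁻¹ * w) (by rw [hmk, ← prodGenerators_eq]; group)
  -- The cyclic word has length `n`, and the letters `x_{π i}` alone already account for `n`.
  have hc0 : ∀ i, c i = [] := by
    have hlen := congrArg List.length hk
    rw [List.length_flatten, List.map_ofFn, List.sum_ofFn] at hlen
    simp only [Function.comp_apply, B, List.length_cons, Finset.sum_add_distrib, List.length_map,
      List.length_rotate, List.length_finRange] at hlen
    have : ∑ i, (c i).length = 0 := by simpa using hlen
    intro i
    have := Finset.sum_eq_zero_iff.1 this i (Finset.mem_univ i)
    exact List.length_eq_zero_iff.1 this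
  have hUU : ∀ i, U (cycSucc i) = U i := by
    intro i
    have h3 := List.append_eq_nil_iff.1 (hc0 i)
    have h4 : u i = [] := by simpa [invRev] using h3.1
    rw [hp i, hq i, h4, h3.2]
  -- The `U i` are one common word, tight for every `π i`. Since `π` is onto, no last letter is
  -- allowed.
  have hU0 : ∀ i, U i = [] := by
    intro i
    by_contra hne
    obtain ⟨l, hl⟩ : ∃ l, l ∈ (U i).getLast? := ⟨(U i).getLast hne, by simp [List.getLast?_eq_some_getLast hne]⟩
    have := (hU (π.symm l.1)).2 l (by rw [eq_of_forall_cycSucc hUU _ i]; exact hl)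
    simp at this
  refine ⟨hU0, ?_⟩
  have h9 : mk (U 0) = 1 := by rw [hU0]; rfl
  -- Since `w` has algebraic length zero, the rotation amount is a multiple of `n`; hence the
  -- rotation is trivial and `π` is the identity.
  simp only [h9, inv_one, one_mul, hw, zero_add, List.length_finRange] at hdvd
  obtain ⟨q, rfl⟩ := Int.natCast_dvd_natCast.1 hdvd
  have h10 : (List.finRange (m + 1)).rotate ((m + 1) * q) = List.finRange (m + 1) := by
    have := List.rotate_length_mul (List.finRange (m + 1)) q
    rwa [List.length_finRange] at this
  rw [h10] at hk
  have h11 : (List.ofFn B).flatten = List.ofFn fun i => (π i, true) := by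
    have : B = fun i => [(π i, true)] := by funext i; simp only [B, hc0 i]
    rw [this]
    have h12 : ∀ L : List (Fin (m + 1)), (L.map fun i => [(π i, true)]).flatten =
        L.map fun i => (π i, true) := by
      intro L; induction L with
      | nil => rfl
      | cons a L ih => simpa using ih
    rw [List.ofFn_eq_map, List.ofFn_eq_map, h12]
  rw [h11, posWord, ← List.ofFn_eq_map] at hk
  intro i
  have := congrFun (List.ofFn_injective hk) i
  simpa using this

end AffineBraid

/-! ### The generators and the total length -/

namespace AffineBraid

open FreeGroup hiding map_mul map_inv map_one

variable {n : ℕ} (hn : 2 ≤ n)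

theorem sigmaAut_self (i : Fin n) :
    sigmaAut hn i (of i) = of i * of (cycSucc i) * (of i)⁻¹ := by
  simp [sigmaAut, braidAut_of]

theorem sigmaAut_succ (i : Fin n) : sigmaAut hn i (of (cycSucc i)) = of i := by
  simp [sigmaAut, braidAut_of, (ne_cycSucc hn i).symm]

theorem sigmaAut_of_ne {i j : Fin n} (h1 : j ≠ i) (h2 : j ≠ cycSucc i) :
    sigmaAut hn i (of j) = of j := by
  simp [sigmaAut, braidAut_of, h1, h2]

theorem sigmaAut_inv_self (i : Fin n) : (sigmaAut hn i)⁻¹ (of i) = of (cycSucc i) := by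
  rw [MulAut.inv_apply, MulEquiv.symm_apply_eq, sigmaAut_succ]

theorem sigmaAut_inv_succ (i : Fin n) :
    (sigmaAut hn i)⁻¹ (of (cycSucc i)) = (of (cycSucc i))⁻¹ * of i * of (cycSucc i) := by
  rw [MulAut.inv_apply, MulEquiv.symm_apply_eq]
  simp only [map_mul, map_inv, sigmaAut_self, sigmaAut_succ]
  group

theorem sigmaAut_inv_of_ne {i j : Fin n} (h1 : j ≠ i) (h2 : j ≠ cycSucc i) :
    (sigmaAut hn i)⁻¹ (of j) = of j := by
  rw [MulAut.inv_apply, MulEquiv.symm_apply_eq, sigmaAut_of_ne hn h1 h2]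

/-- The generator `σ_i` of the representation or its inverse, according to a sign. -/
def sigmaSigned (i : Fin n) (e : Bool) : MulAut (FreeGroup (Fin n)) :=
  if e then sigmaAut hn i else (sigmaAut hn i)⁻¹

@[simp] theorem sigmaSigned_true (i : Fin n) : sigmaSigned hn i true = sigmaAut hn i := rfl

@[simp] theorem sigmaSigned_false (i : Fin n) : sigmaSigned hn i false = (sigmaAut hn i)⁻¹ := rfl

/-- The total length of the images of the generators. -/
def totalLength (φ : MulAut (FreeGroup (Fin n))) : ℕ := ∑ i, norm (φ (of i))

theorem sum_split {i j : Fin n} (hij : i ≠ j) (f : Fin n → ℕ) :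
    ∑ k, f k = f i + f j + ∑ k ∈ (Finset.univ.erase i).erase j, f k := by
  rw [← Finset.add_sum_erase _ f (Finset.mem_univ i),
    ← Finset.add_sum_erase _ f (Finset.mem_erase.2 ⟨hij.symm, Finset.mem_univ j⟩), add_assoc]

/-- One image moves unchanged to the next index, so only the conjugated one contributes to the
difference. The additive form avoids subtraction in `ℕ`. -/
theorem totalLength_mul_sigmaAut (φ : MulAut (FreeGroup (Fin n))) (i : Fin n) :
    totalLength (φ * sigmaAut hn i) + norm (φ (of (cycSucc i))) =
      totalLength φ + norm (φ (of i) * φ (of (cycSucc i)) * (φ (of i))⁻¹) := by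
  rw [totalLength, totalLength, sum_split (ne_cycSucc hn i), sum_split (ne_cycSucc hn i)]
  have : ∀ k ∈ (Finset.univ.erase i).erase (cycSucc i),
      norm ((φ * sigmaAut hn i) (of k)) = norm (φ (of k)) := by
    intro k hk
    simp only [Finset.mem_erase] at hk
    rw [MulAut.mul_apply, sigmaAut_of_ne hn hk.2.1 hk.1]
  rw [Finset.sum_congr rfl this, MulAut.mul_apply, MulAut.mul_apply, sigmaAut_self, sigmaAut_succ]
  simp only [map_mul, map_inv]
  omega

theorem totalLength_mul_sigmaAut_inv (φ : MulAut (FreeGroup (Fin n))) (i : Fin n) :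
    totalLength (φ * (sigmaAut hn i)⁻¹) + norm (φ (of i)) =
      totalLength φ + norm ((φ (of (cycSucc i)))⁻¹ * φ (of i) * φ (of (cycSucc i))) := by
  rw [totalLength, totalLength, sum_split (ne_cycSucc hn i), sum_split (ne_cycSucc hn i)]
  have : ∀ k ∈ (Finset.univ.erase i).erase (cycSucc i),
      norm ((φ * (sigmaAut hn i)⁻¹) (of k)) = norm (φ (of k)) := by
    intro k hk
    simp only [Finset.mem_erase] at hk
    rw [MulAut.mul_apply, sigmaAut_inv_of_ne hn hk.2.1 hk.1]
  rw [Finset.sum_congr rfl this, MulAut.mul_apply, MulAut.mul_apply, sigmaAut_inv_self,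
    sigmaAut_inv_succ]
  simp only [map_mul, map_inv]
  omega

/-- The images of the generators under `φ` are the conjugates `U_i x_{π(i)} U_i⁻¹`, with `U_i` as
short as possible. -/
def IsTightForm (φ : MulAut (FreeGroup (Fin n))) (U : Fin n → List (Fin n × Bool))
    (π : Equiv.Perm (Fin n)) : Prop :=
  ∀ i, IsTight (U i) (π i) ∧ φ (of i) = mk (U i) * of (π i) * (mk (U i))⁻¹

theorem exists_isTightForm {φ : MulAut (FreeGroup (Fin n))} {w : Fin n → FreeGroup (Fin n)}
    {π : Equiv.Perm (Fin n)} (h : ∀ i, φ (of i) = w i * of (π i) * (w i)⁻¹) :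
    ∃ U, IsTightForm φ U π := by
  choose U hU using fun i => exists_isTight (w i) (π i)
  exact ⟨U, fun i => ⟨(hU i).1, by rw [h i, (hU i).2]⟩⟩

/-- Criterion for `φ σ_i^{±1}` to be shorter than `φ`, in terms of the conjugators of `φ`. -/
def IsDescent (U : Fin n → List (Fin n × Bool)) (π : Equiv.Perm (Fin n)) (i : Fin n) (e : Bool) :
    Prop :=
  if e then U i ++ [(π i, false)] <+: U (cycSucc i)
  else U (cycSucc i) ++ [(π (cycSucc i), true)] <+: U i

theorem conj_conj_eq (U V : List (Fin n × Bool)) (x y : Fin n) (e : Bool) :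
    mk (U ++ [(x, e)] ++ invRev U ++ V) * of y * (mk (U ++ [(x, e)] ++ invRev U ++ V))⁻¹ =
      (mk U * mk [(x, e)] * (mk U)⁻¹) * (mk V * of y * (mk V)⁻¹) *
        (mk U * mk [(x, e)] * (mk U)⁻¹)⁻¹ := by
  simp only [← mul_mk, ← inv_mk]
  group

theorem mk_false (x : Fin n) : mk [(x, false)] = (of x)⁻¹ := by
  simp [of, inv_mk, invRev]

theorem mk_true (x : Fin n) : mk [(x, true)] = of x := rfl

theorem conj_cancel_eq (U R : List (Fin n × Bool)) (x y : Fin n) (e : Bool) :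
    (mk U * mk [(x, e)] * (mk U)⁻¹) *
      (mk (U ++ (x, !e) :: R) * of y * (mk (U ++ (x, !e) :: R))⁻¹) *
        (mk U * mk [(x, e)] * (mk U)⁻¹)⁻¹ = mk (U ++ R) * of y * (mk (U ++ R))⁻¹ := by
  rw [show U ++ (x, !e) :: R = U ++ [(x, !e)] ++ R by simp]
  simp only [← mul_mk]
  cases e <;> simp only [Bool.not_true, Bool.not_false, mk_false, mk_true] <;> group

theorem inv_conj (U : List (Fin n × Bool)) (x : Fin n) :
    (mk U * of x * (mk U)⁻¹)⁻¹ = mk U * mk [(x, false)] * (mk U)⁻¹ := by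
  rw [mk_false]; group

variable {φ : MulAut (FreeGroup (Fin n))} {U : Fin n → List (Fin n × Bool)}
  {π : Equiv.Perm (Fin n)}

theorem IsTightForm.norm_eq (h : IsTightForm φ U π) (i : Fin n) :
    norm (φ (of i)) = 2 * (U i).length + 1 := by
  rw [(h i).2, (h i).1.norm_conj]

/-- The letter after the common beginning cancels, so the conjugated image has a conjugator one
letter shorter than before. -/
theorem IsTightForm.totalLength_lt (h : IsTightForm φ U π) {i : Fin n} {e : Bool}
    (hd : IsDescent U π i e) : totalLength (φ * sigmaSigned hn i e) < totalLength φ := by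
  cases e with
  | true =>
    have h1 := totalLength_mul_sigmaAut hn φ i
    obtain ⟨R, hR⟩ : U i ++ [(π i, false)] <+: U (cycSucc i) := hd
    have h2 := conj_cancel_eq (U i) R (π i) (π (cycSucc i)) true
    rw [h.norm_eq, (h i).2, (h (cycSucc i)).2, ← hR] at h1
    simp only [List.append_assoc, List.singleton_append] at h1
    simp only [Bool.not_true, mk_true] at h2
    rw [h2] at h1
    have := norm_conj_le (U i ++ R) (π (cycSucc i))
    simp only [List.length_append, List.length_cons, sigmaSigned_true] at *
    omega
  | false =>
    have h1 := totalLength_mul_sigmaAut_inv hn φ i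
    obtain ⟨R, hR⟩ : U (cycSucc i) ++ [(π (cycSucc i), true)] <+: U i := hd
    have h2 := conj_cancel_eq (U (cycSucc i)) R (π (cycSucc i)) (π i) false
    rw [← inv_conj, inv_inv] at h2
    rw [h.norm_eq, (h i).2, (h (cycSucc i)).2, ← hR] at h1
    simp only [List.append_assoc, List.singleton_append] at h1
    simp only [Bool.not_false] at h2
    rw [h2] at h1
    have := norm_conj_le (U (cycSucc i) ++ R) (π i)
    simp only [List.length_append, List.length_cons, sigmaSigned_false] at *
    omega

/-- The converse of the descent criterion, by `IsTight.lt_norm_conj`. Injectivity of `π` makes the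
two generators distinct, as that lemma needs. -/
theorem IsTightForm.lt_totalLength (h : IsTightForm φ U π) {i : Fin n} {e : Bool}
    (hd : ¬ IsDescent U π i e) : totalLength φ < totalLength (φ * sigmaSigned hn i e) := by
  have hne : π i ≠ π (cycSucc i) := fun h => ne_cycSucc hn i (π.injective h)
  cases e with
  | true =>
    have h1 := totalLength_mul_sigmaAut hn φ i
    have h2 := (h i).1.lt_norm_conj (h (cycSucc i)).1 hne true hd
    rw [conj_conj_eq, mk_true, ← (h i).2, ← (h (cycSucc i)).2] at h2
    rw [h.norm_eq] at h1
    rw [sigmaSigned_true]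
    omega
  | false =>
    have h1 := totalLength_mul_sigmaAut_inv hn φ i
    have h2 := (h (cycSucc i)).1.lt_norm_conj (h i).1 hne.symm false hd
    rw [conj_conj_eq, ← inv_conj, ← (h i).2, ← (h (cycSucc i)).2, inv_inv] at h2
    rw [h.norm_eq] at h1
    rw [sigmaSigned_false]
    omega

/-- `φ` permutes the conjugacy classes of the generators, and conjugates `x_1 ⋯ x_n` by an element
of algebraic length zero. -/
def IsAffineBraidLike (φ : MulAut (FreeGroup (Fin n))) : Prop :=
  (∃ (w : Fin n → FreeGroup (Fin n)) (π : Equiv.Perm (Fin n)),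
    ∀ i : Fin n, φ (of i) = w i * of (π i) * (w i)⁻¹) ∧
  (∃ w : FreeGroup (Fin n), algLength w = 0 ∧
    φ (prodGenerators n) = w * prodGenerators n * w⁻¹)

theorem algLength_apply {w : Fin n → FreeGroup (Fin n)}
    (h : ∀ i, φ (of i) = w i * of (π i) * (w i)⁻¹) (g : FreeGroup (Fin n)) :
    algLength (φ g) = algLength g := by
  induction g using FreeGroup.induction_on with
  | C1 => simp
  | of i => rw [h]; simp
  | inv_of i ih => rw [map_inv, h]; simp
  | mul x y hx hy => simp [hx, hy]

theorem isAffineBraidLike_one : IsAffineBraidLike (1 : MulAut (FreeGroup (Fin n))) :=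
  ⟨⟨fun _ => 1, 1, by simp⟩, ⟨1, by simp, by simp⟩⟩

theorem IsAffineBraidLike.mul {φ ψ : MulAut (FreeGroup (Fin n))} (hφ : IsAffineBraidLike φ)
    (hψ : IsAffineBraidLike ψ) : IsAffineBraidLike (φ * ψ) := by
  obtain ⟨⟨w, π, hw⟩, v, hv, hv'⟩ := hφ
  obtain ⟨⟨w', π', hw'⟩, v', hv0, hv''⟩ := hψ
  refine ⟨⟨fun i => φ (w' i) * w (π' i), π * π', ?_⟩, φ v' * v, ?_, ?_⟩
  · intro i
    rw [MulAut.mul_apply, hw', map_mul, map_mul, hw, map_inv, Equiv.Perm.mul_apply]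
    group
  · rw [algLength_mul, algLength_apply hw, hv, hv0, add_zero]
  · rw [MulAut.mul_apply, hv'', map_mul, map_mul, hv', map_inv]
    group

end AffineBraid

/-! ### The image of the representation -/

namespace AffineBraid

open FreeGroup hiding map_mul map_inv map_one

variable {n : ℕ} (hn : 2 ≤ n)

theorem IsAffineBraidLike.inv {φ : MulAut (FreeGroup (Fin n))} (hφ : IsAffineBraidLike φ) :
    IsAffineBraidLike φ⁻¹ := by
  obtain ⟨⟨w, π, hw⟩, v, hv, hv'⟩ := hφ
  have hinv : ∀ x, φ⁻¹ (φ x) = x := fun x => by rw [← MulAut.mul_apply, inv_mul_cancel]; rfl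
  have hinv' : ∀ x, φ (φ⁻¹ x) = x := fun x => by rw [← MulAut.mul_apply, mul_inv_cancel]; rfl
  refine ⟨⟨fun i => (φ⁻¹ (w (π⁻¹ i)))⁻¹, π⁻¹, ?_⟩, (φ⁻¹ v)⁻¹, ?_, ?_⟩
  · intro i
    have h := congrArg (DFunLike.coe φ⁻¹) (hw (π⁻¹ i))
    rw [hinv, map_mul, map_mul, map_inv] at h
    have h2 : π (π⁻¹ i) = i := by simp
    rw [h2] at h
    rw [h]
    group
  · rw [algLength_inv, ← algLength_apply hw, hinv', hv, neg_zero]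
  · have h := congrArg (DFunLike.coe φ⁻¹) hv'
    rw [hinv, map_mul, map_mul, map_inv] at h
    nth_rw 2 [h]
    group

theorem map_prodGenerators (φ : MulAut (FreeGroup (Fin n))) :
    φ (prodGenerators n) = (List.ofFn fun i => φ (of i)).prod := by
  rw [prodGenerators, map_list_prod, List.map_ofFn]; rfl

theorem map_prod_eq_self {β G : Type*} [Group G] (φ : MulAut G) (f : β → G) (L : List β)
    (h : ∀ b ∈ L, φ (f b) = f b) : φ (L.map f).prod = (L.map f).prod := by
  rw [map_list_prod, List.map_map]
  exact congrArg List.prod (List.map_congr_left h)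

theorem sigmaAut_prodGenerators_of_lt {i : Fin n} (hi : i.1 + 1 < n) :
    sigmaAut hn i (prodGenerators n) = prodGenerators n := by
  have hs : (⟨i.1 + 1, hi⟩ : Fin n) = cycSucc i := by simp [cycSucc, Nat.mod_eq_of_lt hi]
  obtain ⟨A, B, hAB⟩ : ∃ A B, List.finRange n = A ++ i :: cycSucc i :: B := by
    refine ⟨(List.finRange n).take i, (List.finRange n).drop (i + 2), ?_⟩
    conv_lhs => rw [← List.take_append_drop i (List.finRange n)]
    rw [List.drop_eq_getElem_cons (by simp), List.drop_eq_getElem_cons (by simpa using hi),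
      List.getElem_finRange, List.getElem_finRange]
    simp [← hs]
  have hnd := List.nodup_finRange n
  rw [hAB, List.nodup_append] at hnd
  obtain ⟨-, h1, h2⟩ := hnd
  rw [List.nodup_cons, List.nodup_cons] at h1
  rw [prodGenerators, List.ofFn_eq_map, hAB]
  simp only [List.map_append, List.map_cons, List.prod_append, List.prod_cons, map_mul,
    sigmaAut_self, sigmaAut_succ]
  rw [map_prod_eq_self, map_prod_eq_self]
  · group
  · intro b hb
    refine sigmaAut_of_ne hn ?_ ?_
    · rintro rfl; exact h1.1 (List.mem_cons_of_mem _ hb)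
    · rintro rfl; exact h1.2.1 hb
  · intro b hb
    refine sigmaAut_of_ne hn ?_ ?_
    · exact h2 b hb i (by simp)
    · exact h2 b hb (cycSucc i) (by simp)

/-- The generator at the wrap-around is the only one that moves `x_1 ⋯ x_n`; its conjugator `x_n
x_1⁻¹` has algebraic length zero. -/
theorem sigmaAut_prodGenerators_last {i : Fin n} (hi : ¬ i.1 + 1 < n) :
    sigmaAut hn i (prodGenerators n) =
      (of i * (of (cycSucc i))⁻¹) * prodGenerators n * (of i * (of (cycSucc i))⁻¹)⁻¹ := by
  obtain ⟨m, rfl⟩ : ∃ m, n = m + 2 := ⟨n - 2, by omega⟩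
  obtain rfl : i = Fin.last (m + 1) := by ext; simp; omega
  have hs : cycSucc (Fin.last (m + 1)) = 0 := by ext; simp [cycSucc]
  have hP : prodGenerators (m + 2) = of 0 *
      ((List.finRange m).map fun j => of j.castSucc.succ).prod * of (Fin.last (m + 1)) := by
    rw [prodGenerators, List.ofFn_succ, List.ofFn_succ']
    simp [List.ofFn_eq_map, mul_assoc]
  have h1 := sigmaAut_succ hn (Fin.last (m + 1))
  rw [hs] at h1
  rw [hP, map_mul, map_mul, map_prod_eq_self, sigmaAut_self, hs, h1]
  · group
  · intro j _
    refine sigmaAut_of_ne hn ?_ ?_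
    · intro h; have := congrArg Fin.val h; simp at this; omega
    · rw [hs]; exact Fin.succ_ne_zero _

theorem isAffineBraidLike_sigmaAut (i : Fin n) : IsAffineBraidLike (sigmaAut hn i) := by
  constructor
  · refine ⟨fun j => if j = i then of i else 1, Equiv.swap i (cycSucc i), ?_⟩
    intro j
    by_cases h1 : j = i
    · subst h1; simp [sigmaAut_self]
    · by_cases h2 : j = cycSucc i
      · subst h2; simp [sigmaAut_succ, h1]
      · simp [sigmaAut_of_ne hn h1 h2, h1, Equiv.swap_apply_of_ne_of_ne h1 h2]
  · by_cases hi : i.1 + 1 < n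
    · exact ⟨1, by simp, by simpa using sigmaAut_prodGenerators_of_lt hn hi⟩
    · exact ⟨_, by simp, sigmaAut_prodGenerators_last hn hi⟩

theorem isAffineBraidLike_sigmaSigned (i : Fin n) (e : Bool) :
    IsAffineBraidLike (sigmaSigned hn i e) := by
  cases e
  · exact (isAffineBraidLike_sigmaAut hn i).inv
  · exact isAffineBraidLike_sigmaAut hn i

/-- The generator `σ_i` of the affine braid group or its inverse, according to a sign. -/
def signedGen (i : Fin n) (e : Bool) : AffineBraidGroup n :=
  if e then PresentedGroup.of i else (PresentedGroup.of i)⁻¹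

theorem rhoAff_signedGen (i : Fin n) (e : Bool) :
    rhoAff hn (signedGen i e) = sigmaSigned hn i e := by
  cases e <;> simp [signedGen, rhoAff, PresentedGroup.toGroup.of]

theorem affineBraid_induction {p : AffineBraidGroup n → Prop} (one : p 1)
    (mul : ∀ g i e, p g → p (g * signedGen i e)) (g : AffineBraidGroup n) : p g := by
  have hg : g ∈ Subgroup.closure (Set.range (PresentedGroup.of
      (rels := {r : FreeGroup (Fin n) | AffineBraidRelator n r}))) := by
    rw [PresentedGroup.closure_range_of]; trivial
  induction hg using Subgroup.closure_induction_right with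
  | one => exact one
  | mul_right x y hy hx ih => obtain ⟨i, rfl⟩ := hx; exact mul _ i true ih
  | mul_inv_cancel x y hy hx ih => obtain ⟨i, rfl⟩ := hx; exact mul _ i false ih

theorem isAffineBraidLike_rhoAff (g : AffineBraidGroup n) : IsAffineBraidLike (rhoAff hn g) := by
  induction g using affineBraid_induction with
  | one => rw [map_one]; exact isAffineBraidLike_one
  | mul g i e ih =>
    rw [map_mul, rhoAff_signedGen]
    exact ih.mul (isAffineBraidLike_sigmaSigned hn i e)

theorem exists_isDescent {φ : MulAut (FreeGroup (Fin n))} (hφ : IsAffineBraidLike φ)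
    (h1 : φ ≠ 1) : ∃ i e, totalLength (φ * sigmaSigned hn i e) < totalLength φ := by
  obtain ⟨⟨w, π, hw⟩, v, hv, hv'⟩ := hφ
  obtain ⟨U, hU⟩ := exists_isTightForm hw
  by_contra! hcon
  have hnd : ∀ i e, ¬ IsDescent U π i e := fun i e hd =>
    absurd (hU.totalLength_lt hn hd) (not_lt.2 (hcon i e))
  rw [map_prodGenerators] at hv'
  simp only [fun i => (hU i).2] at hv'
  obtain ⟨h2, h3⟩ := eq_generators_of_no_descent (by omega) (fun i => (hU i).1) hv hv'
    (fun i => hnd i true) (fun i => hnd i false)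
  apply h1
  apply mulAut_ext_of
  intro j
  rw [(hU j).2, h2, h3]
  simp [← one_eq_mk]

theorem IsAffineBraidLike.mem_range {φ : MulAut (FreeGroup (Fin n))}
    (hφ : IsAffineBraidLike φ) : φ ∈ (rhoAff hn).range := by
  induction hN : totalLength φ using Nat.strong_induction_on generalizing φ with
  | _ N ih =>
    by_cases h1 : φ = 1
    · rw [h1]; exact one_mem _
    · obtain ⟨i, e, hlt⟩ := exists_isDescent hn hφ h1
      have h2 := ih _ (hN ▸ hlt) (hφ.mul (isAffineBraidLike_sigmaSigned hn i e)) rfl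
      have h3 : sigmaSigned hn i e ∈ (rhoAff hn).range := ⟨_, rhoAff_signedGen hn i e⟩
      simpa using mul_mem h2 (inv_mem h3)

end AffineBraid

namespace AffineBraid

open FreeGroup hiding map_mul map_inv map_one

/-! ### A circle homeomorphism with one fixed point, lifted to the line -/

section Bend

/-- The increasing piecewise linear self-map of the line fixing `0` and `1` and sending `t` to
`1 - t`, with a single break at `t`. -/
noncomputable def bend (t r : ℝ) : ℝ :=
  if r ≤ t then (1 - t) / t * r else 1 - t + t / (1 - t) * (r - t)

variable {t : ℝ}

theorem bend_of_le {r : ℝ} (h : r ≤ t) : bend t r = (1 - t) / t * r := if_pos h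

theorem bend_of_ge (h0 : 0 < t) {r : ℝ} (h : t ≤ r) :
    bend t r = 1 - t + t / (1 - t) * (r - t) := by
  rcases h.eq_or_lt with rfl | h
  · rw [bend_of_le le_rfl, sub_self, mul_zero, add_zero, div_mul_cancel₀ _ h0.ne']
  · exact if_neg (not_le.2 h)

theorem bend_self (h0 : 0 < t) : bend t t = 1 - t := by rw [bend_of_ge h0 le_rfl]; ring

theorem bend_strictMono (h0 : 0 < t) (h1 : t < 1) : StrictMono (bend t) := by
  have s1 : 0 < (1 - t) / t := div_pos (by linarith) h0
  have s2 : 0 < t / (1 - t) := div_pos h0 (by linarith)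
  have hle : ∀ a b, a < b → b ≤ t → bend t a < bend t b := by
    intro a b hab hb
    rw [bend_of_le (hab.le.trans hb), bend_of_le hb]
    exact mul_lt_mul_of_pos_left hab s1
  have hge : ∀ a b, a < b → t ≤ a → bend t a < bend t b := by
    intro a b hab ha
    rw [bend_of_ge h0 ha, bend_of_ge h0 (ha.trans hab.le)]
    have := mul_lt_mul_of_pos_left hab s2
    linarith
  intro a b hab
  by_cases hb : b ≤ t
  · exact hle a b hab hb
  · by_cases ha : t ≤ a
    · exact hge a b hab ha
    · push Not at ha hb
      exact (hle a t ha le_rfl).trans (hge t b hb le_rfl)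

theorem bend_zero (h0 : 0 < t) : bend t 0 = 0 := by rw [bend_of_le h0.le, mul_zero]

theorem bend_one (h0 : 0 < t) (h1 : t < 1) : bend t 1 = 1 := by
  rw [bend_of_ge h0 h1.le, div_mul_cancel₀ _ (by linarith)]; ring

theorem bend_bend (h0 : 0 < t) (h1 : t < 1) (r : ℝ) : bend t (bend (1 - t) r) = r := by
  have h2 : 1 - t ≠ 0 := by linarith
  rcases le_total r (1 - t) with h | h
  · have h3 := (bend_strictMono (t := 1 - t) (by linarith) (by linarith)).monotone h
    rw [bend_self (by linarith), sub_sub_cancel] at h3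
    rw [bend_of_le h3, bend_of_le h]
    field_simp
    ring
  · have h3 := (bend_strictMono (t := 1 - t) (by linarith) (by linarith)).monotone h
    rw [bend_self (by linarith), sub_sub_cancel] at h3
    rw [bend_of_ge h0 h3, bend_of_ge (by linarith) h]
    simp only [sub_sub_cancel]
    field_simp
    ring

/-- For `t < 1 / 2` the graph leaves `0` with slope greater than `1` and reaches `(1, 1)` with slope
less than `1`, so it lies above the diagonal in between. -/
theorem bend_eq_self (h0 : 0 < t) (h1 : t < 1 / 2) {r : ℝ} (hr0 : 0 ≤ r) (hr1 : r < 1)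
    (h : bend t r = r) : r = 0 := by
  have h2 : 0 < 1 - t := by linarith
  rcases le_total r t with hr | hr
  · rw [bend_of_le hr] at h
    have h3 : 1 < (1 - t) / t := by rw [lt_div_iff₀ h0]; linarith
    by_contra hne
    have hpos : 0 < r := lt_of_le_of_ne hr0 (Ne.symm hne)
    nlinarith
  · rw [bend_of_ge h0 hr] at h
    have h3 : t / (1 - t) < 1 := by rw [div_lt_one h2]; linarith
    have h4 : t / (1 - t) * (1 - t) = t := div_mul_cancel₀ _ h2.ne'
    nlinarith

/-- The map of the circle `ℝ / ℤ` given by `bend t`, lifted to the line. -/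
noncomputable def bendLift (t x : ℝ) : ℝ := ⌊x⌋ + bend t (Int.fract x)

theorem bend_fract_mem (h0 : 0 < t) (h1 : t < 1) (x : ℝ) :
    0 ≤ bend t (Int.fract x) ∧ bend t (Int.fract x) < 1 := by
  have h2 := (bend_strictMono h0 h1).monotone (Int.fract_nonneg x)
  have h3 := bend_strictMono h0 h1 (Int.fract_lt_one x)
  rw [bend_zero h0] at h2
  rw [bend_one h0 h1] at h3
  exact ⟨h2, h3⟩

theorem bendLift_strictMono (h0 : 0 < t) (h1 : t < 1) : StrictMono (bendLift t) := by
  intro x y hxy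
  have hx := bend_fract_mem h0 h1 x
  have hy := bend_fract_mem h0 h1 y
  unfold bendLift
  rcases (Int.floor_mono hxy.le).eq_or_lt with h | h
  · have : Int.fract x < Int.fract y := by
      unfold Int.fract; rw [h]; linarith
    have := bend_strictMono h0 h1 this
    rw [h]; linarith
  · have : (⌊x⌋ : ℝ) + 1 ≤ ⌊y⌋ := by exact_mod_cast h
    linarith

theorem bendLift_bendLift (h0 : 0 < t) (h1 : t < 1) (x : ℝ) :
    bendLift t (bendLift (1 - t) x) = x := by
  have hx := bend_fract_mem (t := 1 - t) (by linarith) (by linarith) x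
  have h2 : ⌊bendLift (1 - t) x⌋ = ⌊x⌋ := by
    rw [Int.floor_eq_iff]; unfold bendLift; constructor <;> linarith
  have h3 : Int.fract (bendLift (1 - t) x) = bend (1 - t) (Int.fract x) := by
    unfold Int.fract; rw [h2]; unfold bendLift Int.fract; ring
  rw [bendLift, h3, h2, bend_bend h0 h1]
  exact Int.floor_add_fract x

/-- There is an increasing homeomorphism of the line, commuting with the unit translation, which
fixes exactly the integers and sends `t` to `1 - t`. -/
theorem exists_orderIso (h0 : 0 < t) (h1 : t < 1 / 2) :
    ∃ f : ℝ ≃o ℝ, f 0 = 0 ∧ f t = 1 - t ∧ (∀ x, f (x + 1) = f x + 1) ∧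
      ∀ x, f x = x → ∃ m : ℤ, x = m := by
  have h1' : t < 1 := by linarith
  refine ⟨StrictMono.orderIsoOfRightInverse _ (bendLift_strictMono h0 h1') _
    (bendLift_bendLift h0 h1'), ?_, ?_, ?_, ?_⟩
  · simp [bendLift, bend_zero h0]
  · have h2 : ⌊t⌋ = 0 := by rw [Int.floor_eq_zero_iff]; exact ⟨h0.le, h1'⟩
    have h3 : Int.fract t = t := by unfold Int.fract; rw [h2]; simp
    simp [bendLift, h2, h3, bend_self h0]
  · intro x
    simp [bendLift]; ring
  · intro x hx
    have h2 : bend t (Int.fract x) = Int.fract x := by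
      have h3 : bendLift t x = x := hx
      unfold bendLift at h3
      have := Int.floor_add_fract x
      linarith
    have h4 := bend_eq_self h0 h1 (Int.fract_nonneg x) (Int.fract_lt_one x) h2
    exact ⟨⌊x⌋, by have := Int.floor_add_fract x; linarith⟩

end Bend

/-! ### The polygon action and ping-pong -/

section Action

variable {n : ℕ}

/-- An action of the free group on the line by increasing homeomorphisms that commute with the unit
translation; modulo that translation, `x_j` is parabolic with fixed point `j / n`, and it pairs the
two sides at this vertex of the ideal polygon with vertices the multiples of `1 / (2 n)`. -/
structure IsPolygonAction (n : ℕ) (α : FreeGroup (Fin n) →* (ℝ ≃o ℝ)) : Prop where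
  add_one : ∀ g x, α g (x + 1) = α g x + 1
  vertex : ∀ j : Fin n, α (of j) ((j : ℝ) / n) = (j : ℝ) / n
  side : ∀ j : Fin n, α (of j) ((j : ℝ) / n + 1 / (2 * n)) = (j : ℝ) / n - 1 / (2 * n) + 1
  fixed : ∀ (j : Fin n) (x : ℝ), α (of j) x = x → ∃ m : ℤ, x = (j : ℝ) / n + m

theorem orderIso_inv_add_one {f : ℝ ≃o ℝ} (h : ∀ x, f (x + 1) = f x + 1) (x : ℝ) :
    f⁻¹ (x + 1) = f⁻¹ x + 1 := by
  apply f.injective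
  rw [h, RelIso.apply_inv_self, RelIso.apply_inv_self]

theorem orderIso_sub_one {f : ℝ ≃o ℝ} (h : ∀ x, f (x + 1) = f x + 1) (x : ℝ) :
    f (x - 1) = f x - 1 := by
  have := h (x - 1)
  rw [sub_add_cancel] at this
  linarith

theorem orderIso_add_int {f : ℝ ≃o ℝ} (h : ∀ x, f (x + 1) = f x + 1) (x : ℝ) (m : ℤ) :
    f (x + m) = f x + m := by
  induction m using Int.induction_on with
  | zero => simp
  | succ k ih => push_cast at ih ⊢; rw [← add_assoc, h, ih]; ring
  | pred k ih => push_cast at ih ⊢; rw [← add_sub_assoc, orderIso_sub_one h, ih]; ring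

theorem exists_isPolygonAction (hn : 2 ≤ n) :
    ∃ α : FreeGroup (Fin n) →* (ℝ ≃o ℝ), IsPolygonAction n α := by
  have hn' : (2 : ℝ) ≤ n := by exact_mod_cast hn
  -- The value `t = 1 / (2 n)` is the distance from a vertex `j / n` to its adjacent polygon
  -- vertices; conjugating by translations puts the fixed point at `j / n`.
  obtain ⟨f, hf0, hf1, hf2, hf3⟩ := exists_orderIso (t := 1 / (2 * n)) (by positivity) (by
    rw [div_lt_div_iff₀ (by positivity) (by norm_num)]; linarith)
  let A : Fin n → (ℝ ≃o ℝ) := fun j =>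
    OrderIso.addRight ((j : ℝ) / n) * f * (OrderIso.addRight ((j : ℝ) / n))⁻¹
  have hA : ∀ j x, A j x = f (x - (j : ℝ) / n) + (j : ℝ) / n := by
    intro j x
    have : (OrderIso.addRight ((j : ℝ) / n))⁻¹ x = x - (j : ℝ) / n := by
      apply (OrderIso.addRight ((j : ℝ) / n)).injective
      rw [RelIso.apply_inv_self]
      simp
    simp [A, RelIso.mul_apply, this]
  have hA1 : ∀ j x, A j (x + 1) = A j x + 1 := by
    intro j x
    rw [hA, hA, show x + 1 - (j : ℝ) / n = x - j / n + 1 by ring, hf2]; ring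
  refine ⟨FreeGroup.lift A, ?_, ?_, ?_, ?_⟩
  · intro g
    induction g using FreeGroup.induction_on with
    | C1 => simp
    | of i => simpa using hA1 i
    | inv_of i ih => simpa using orderIso_inv_add_one (hA1 i)
    | mul x y hx hy => intro z; rw [map_mul, RelIso.mul_apply, RelIso.mul_apply, hy, hx]
  · intro j; simp [hA, hf0]
  · intro j; rw [lift_apply_of, hA, add_sub_cancel_left, hf1]; ring
  · intro j x hx
    rw [lift_apply_of, hA] at hx
    obtain ⟨m, hm⟩ := hf3 (x - (j : ℝ) / n) (by linarith)
    exact ⟨m, by linarith⟩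

/-- The point `q` lies, up to integer translation, in the sector of words beginning with
`x_y` (for `b = true`) or with `x_y⁻¹` (for `b = false`). -/
def InSector (n : ℕ) (y : Fin n) (b : Bool) (q : ℝ) : Prop :=
  ∃ m : ℤ, if b then (y : ℝ) / n - 1 / (2 * n) + m < q ∧ q < (y : ℝ) / n + m
    else (y : ℝ) / n + m < q ∧ q < (y : ℝ) / n + 1 / (2 * n) + m

theorem InSector.mem_Ioo {y : Fin n} {b : Bool} {q : ℝ} (hn : 0 < n) (h : InSector n y b q) :
    ∃ m : ℤ, (y : ℝ) / n - 1 / (2 * n) + m < q ∧ q < (y : ℝ) / n + 1 / (2 * n) + m := by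
  have : (0 : ℝ) < 1 / (2 * n) := by positivity
  obtain ⟨m, hm⟩ := h
  refine ⟨m, ?_⟩
  cases b
  · simp only [Bool.false_eq_true, if_false] at hm; constructor <;> linarith
  · simp only [if_true] at hm; constructor <;> linarith

/-- The intervals of radius `1 / (2 n)` about distinct vertices have disjoint interiors modulo `1`,
so a translate of one fits in the gap left by the other. That gap is where ping-pong starts. -/
theorem exists_int_of_ne (hn : 0 < n) {l y : Fin n} (h : l ≠ y) : ∃ m : ℤ,
    (y : ℝ) / n + 1 / (2 * n) ≤ (l : ℝ) / n - 1 / (2 * n) + m ∧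
      (l : ℝ) / n + 1 / (2 * n) + m ≤ (y : ℝ) / n - 1 / (2 * n) + 1 := by
  have hn' : (0 : ℝ) < n := by exact_mod_cast hn
  have e1 : ∀ a b : ℝ, a + 1 ≤ b → a / n + 1 / (2 * n) ≤ b / n - 1 / (2 * n) := by
    intro a b hab
    rw [show a / n + 1 / (2 * n) = (a + 1 / 2) / n by field_simp,
      show b / n - 1 / (2 * n) = (b - 1 / 2) / n by field_simp, div_le_div_iff_of_pos_right hn']
    linarith
  have e2 : ∀ a : ℝ, (a + n) / n = a / n + 1 := by intro a; field_simp
  rcases lt_or_gt_of_ne (fun h' => h (Fin.ext h') : l.1 ≠ y.1) with h1 | h1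
  · refine ⟨1, ?_, ?_⟩
    · have := e1 y (l + n) (by
        have := y.2
        exact_mod_cast (by omega : y.1 + 1 ≤ l.1 + n))
      rw [e2] at this
      push_cast; linarith
    · have := e1 l y (by exact_mod_cast h1)
      push_cast; linarith
  · refine ⟨0, ?_, ?_⟩
    · have := e1 y l (by exact_mod_cast h1)
      push_cast; linarith
    · have := e1 l (y + n) (by
        have := l.2
        exact_mod_cast (by omega : l.1 + 1 ≤ y.1 + n))
      rw [e2] at this
      push_cast; linarith

variable {α : FreeGroup (Fin n) →* (ℝ ≃o ℝ)}

/-- The ping-pong step: `x_y^{±1}` sends everything beyond both sides at its vertex into its own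
sector, and sends that sector into itself. The second case handles repeated letters. -/
theorem IsPolygonAction.inSector_of_mem (hα : IsPolygonAction n α) (hn : 2 ≤ n) {y : Fin n}
    {b : Bool} {q : ℝ} (h : (∃ m : ℤ, (y : ℝ) / n + 1 / (2 * n) + m < q ∧
      q < (y : ℝ) / n - 1 / (2 * n) + 1 + m) ∨ InSector n y b q) :
    InSector n y b (α (FreeGroup.mk [(y, b)]) q) := by
  have hn' : (2 : ℝ) ≤ n := by exact_mod_cast hn
  have ht : (1 : ℝ) / (2 * n) ≤ 1 / 4 := by
    rw [div_le_div_iff₀ (by positivity) (by norm_num)]; linarith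
  have ht0 : (0 : ℝ) < 1 / (2 * n) := by positivity
  have hv := fun m : ℤ => orderIso_add_int (hα.add_one (of y)) ((y : ℝ) / n) m
  have hs := fun m : ℤ => orderIso_add_int (hα.add_one (of y)) ((y : ℝ) / n + 1 / (2 * n)) m
  rw [hα.vertex] at hv
  rw [hα.side] at hs
  cases b with
  | true =>
    obtain ⟨m, hm1, hm2⟩ : ∃ m : ℤ, (y : ℝ) / n + 1 / (2 * n) + m < q ∧
        q < (y : ℝ) / n + (m + 1 : ℤ) := by
      rcases h with ⟨m, h1, h2⟩ | ⟨m, hm⟩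
      · exact ⟨m, h1, by push_cast; linarith⟩
      · simp only [if_true] at hm
        exact ⟨m - 1, by push_cast; linarith, by simpa using hm.2⟩
    refine ⟨m + 1, ?_⟩
    rw [mk_true]
    simp only [if_true]
    have h1 := (α (of y)).strictMono hm1
    have h2 := (α (of y)).strictMono hm2
    rw [hs] at h1
    rw [hv] at h2
    push_cast at *
    constructor <;> linarith
  | false =>
    obtain ⟨m, hm1, hm2⟩ : ∃ m : ℤ, (y : ℝ) / n + m < q ∧
        q < (y : ℝ) / n - 1 / (2 * n) + 1 + m := by
      rcases h with ⟨m, h1, h2⟩ | ⟨m, hm⟩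
      · exact ⟨m, by linarith, h2⟩
      · simp only [Bool.false_eq_true, if_false] at hm
        exact ⟨m, hm.1, by linarith⟩
    refine ⟨m, ?_⟩
    rw [mk_false, map_inv]
    simp only [Bool.false_eq_true, if_false]
    constructor
    · rw [← (α (of y)).lt_iff_lt, RelIso.apply_inv_self, hv]; exact hm1
    · rw [← (α (of y)).lt_iff_lt, RelIso.apply_inv_self, hs]; exact hm2

/-- The first letter of a word determines the sector in which it sends the vertices. -/
theorem IsPolygonAction.inSector (hα : IsPolygonAction n α) (hn : 2 ≤ n)
    (R : List (Fin n × Bool)) (y : Fin n) (b : Bool) (j : Fin n) (z : ℤ)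
    (h : IsTight ((y, b) :: R) j) :
    InSector n y b (α (FreeGroup.mk ((y, b) :: R)) ((j : ℝ) / n + z)) := by
  have ht0 : (0 : ℝ) < 1 / (2 * n) := by positivity
  induction R generalizing y b with
  | nil =>
    refine hα.inSector_of_mem hn (Or.inl ?_)
    have hjy : j ≠ y := by have := h.2 (y, b) (by simp); exact fun h => this h.symm
    obtain ⟨m, h1, h2⟩ := exists_int_of_ne (by omega) hjy
    refine ⟨z - m, ?_, ?_⟩ <;> push_cast <;> linarith
  | cons l R ih =>
    obtain ⟨l, e⟩ := l
    have h2 := isReduced_cons_cons.1 h.1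
    have h3 := ih l e ⟨h2.2, fun c hc => h.2 c (by simpa using hc)⟩
    have hmk : FreeGroup.mk ((y, b) :: (l, e) :: R) = FreeGroup.mk [(y, b)] * FreeGroup.mk ((l, e) :: R) := by
      rw [mul_mk]; rfl
    rw [hmk, map_mul, RelIso.mul_apply]
    refine hα.inSector_of_mem hn ?_
    by_cases hly : l = y
    · right
      have : b = e := h2.1 hly.symm
      rw [this, ← hly]; exact h3
    · left
      obtain ⟨k, h4, h5⟩ := h3.mem_Ioo (by omega)
      obtain ⟨m, h6, h7⟩ := exists_int_of_ne (by omega) hly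
      refine ⟨k - m, ?_, ?_⟩ <;> push_cast <;> linarith

end Action

end AffineBraid

namespace AffineBraid

open FreeGroup hiding map_mul map_inv map_one

/-! ### Polygons carried along by braids -/

section Marking

variable {n : ℕ}

/-- The homeomorphisms `A k` pair the sides of an ideal polygon with vertices
`⋯ < p k < d k < p (k + 1) < ⋯`, modulo the unit translation, and fix the vertices `p k`. -/
structure IsMarking (n : ℕ) (A : ℤ → (ℝ ≃o ℝ)) (p d : ℤ → ℝ) : Prop where
  p_lt_d : ∀ k, p k < d k
  d_lt_p : ∀ k, d k < p (k + 1)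
  p_add : ∀ k, p (k + n) = p k + 1
  d_add : ∀ k, d (k + n) = d k + 1
  map_p : ∀ k, A k (p k) = p k
  map_d : ∀ k, A k (d k) = d (k - 1) + 1

variable {A A' : ℤ → (ℝ ≃o ℝ)} {p d : ℤ → ℝ}

theorem IsMarking.p_strictMono (h : IsMarking n A p d) : StrictMono p :=
  strictMono_int_of_lt_succ fun k => (h.p_lt_d k).trans (h.d_lt_p k)

theorem IsMarking.lt_add_one (h : IsMarking n A p d) (hn : 2 ≤ n) (k : ℤ) :
    d (k + 1) < p k + 1 := by
  have h1 := h.d_lt_p (k + 1)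
  have h2 := h.p_strictMono.monotone (show k + 1 + 1 ≤ k + n by omega)
  rw [h.p_add] at h2
  exact h1.trans_le h2

/-- At an index `k` in `S` the new vertices lie in the order `d (k-1) < A_k p (k+1) - 1 < A_k d
(k+1) - 1 < p k < d (k+1)`: the piece about `p (k+1)` is moved by `A_k` to just before `p k`. The
set `S` is a residue class modulo `n`, and no two of its members are consecutive, so these moves do
not interfere. -/
theorem IsMarking.exists_mul_sigma (h : IsMarking n A p d) (hn : 2 ≤ n)
    (hA : ∀ k x, A k (x + 1) = A k x + 1) (hper : ∀ k, A (k + n) = A k)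
    {S : ℤ → Prop} (hS : ∀ k, S (k + n) ↔ S k) (hS' : ∀ k, S k → ¬ S (k + 1))
    (h1 : ∀ k, S k → A' k = A k * A (k + 1) * (A k)⁻¹) (h2 : ∀ k, S (k - 1) → A' k = A (k - 1))
    (h3 : ∀ k, ¬ S k → ¬ S (k - 1) → A' k = A k) :
    ∃ p' d', IsMarking n A' p' d' := by
  classical
  have hS0 : ∀ k, S (k - 1) → ¬ S k := fun k hk => by simpa using hS' _ hk
  have key1 : ∀ k, d (k - 1) < A k (p (k + 1)) - 1 := by
    intro k
    have := (A k).strictMono (h.d_lt_p k)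
    rw [h.map_d] at this
    linarith
  -- This uses `d (k + 1) < p k + 1`, which needs at least two vertices per period.
  have key2 : ∀ k, A k (d (k + 1)) - 1 < p k := by
    intro k
    have := (A k).strictMono (h.lt_add_one hn k)
    rw [hA, h.map_p] at this
    linarith
  let p' : ℤ → ℝ := fun k => if S k then A k (p (k + 1)) - 1 else if S (k - 1) then p (k - 1) else p k
  let d' : ℤ → ℝ := fun k => if S k then A k (d (k + 1)) - 1 else d k
  have p1 : ∀ k, S k → p' k = A k (p (k + 1)) - 1 := fun k hk => by simp [p', hk]
  have p2 : ∀ k, S (k - 1) → p' k = p (k - 1) := fun k hk => by simp [p', hk, hS0 k hk]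
  have p3 : ∀ k, ¬ S k → ¬ S (k - 1) → p' k = p k := fun k hk hk' => by simp [p', hk, hk']
  have d1 : ∀ k, S k → d' k = A k (d (k + 1)) - 1 := fun k hk => by simp [d', hk]
  have d2 : ∀ k, ¬ S k → d' k = d k := fun k hk => by simp [d', hk]
  refine ⟨p', d', ?_, ?_, ?_, ?_, ?_, ?_⟩
  · intro k
    by_cases hk : S k
    · rw [p1 k hk, d1 k hk]
      have := (A k).strictMono (h.p_lt_d (k + 1))
      linarith
    by_cases hk' : S (k - 1)
    · rw [p2 k hk', d2 k hk]
      exact (h.p_strictMono (by omega : k - 1 < k)).trans (h.p_lt_d k)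
    · rw [p3 k hk hk', d2 k hk]; exact h.p_lt_d k
  · intro k
    by_cases hk : S k
    · rw [d1 k hk, p2 (k + 1) (by simpa using hk), add_sub_cancel_right]; exact key2 k
    rw [d2 k hk]
    by_cases hk' : S (k + 1)
    · rw [p1 _ hk']; simpa using key1 (k + 1)
    · rw [p3 _ hk' (by simpa using hk)]; exact h.d_lt_p k
  · intro k
    have e1 : k + (n : ℤ) + 1 = k + 1 + n := by ring
    have e2 : k + (n : ℤ) - 1 = k - 1 + n := by ring
    simp only [p', hS, e1, e2, h.p_add, hper, hA]
    split_ifs <;> ring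
  · intro k
    have e1 : k + (n : ℤ) + 1 = k + 1 + n := by ring
    simp only [d', hS, e1, h.d_add, hper, hA]
    split_ifs <;> ring
  · intro k
    by_cases hk : S k
    · rw [p1 k hk, h1 k hk, RelIso.mul_apply, RelIso.mul_apply,
        orderIso_sub_one (orderIso_inv_add_one (hA k)), RelIso.inv_apply_self,
        orderIso_sub_one (hA _), h.map_p, orderIso_sub_one (hA _)]
    by_cases hk' : S (k - 1)
    · rw [p2 k hk', h2 k hk', h.map_p]
    · rw [p3 k hk hk', h3 k hk hk', h.map_p]
  · intro k
    by_cases hk : S k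
    · have hk' : ¬ S (k - 1) := fun h' => hS0 k h' hk
      rw [d1 k hk, d2 _ hk', h1 k hk, RelIso.mul_apply, RelIso.mul_apply,
        orderIso_sub_one (orderIso_inv_add_one (hA k)), RelIso.inv_apply_self,
        orderIso_sub_one (hA _), h.map_d, add_sub_cancel_right, add_sub_cancel_right, h.map_d]
    by_cases hk' : S (k - 1)
    · rw [d2 k hk, d1 _ hk', h2 k hk']; simp
    · rw [d2 k hk, d2 _ hk', h3 k hk hk', h.map_d]

/-- The reverse move: for `k` in `S`, the translate by one of the piece from `d (k-1)` to `p k` is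
pulled back by `A_{k+1}` between `p (k+1)` and `d (k+1)`. -/
theorem IsMarking.exists_mul_sigma_inv (h : IsMarking n A p d) (hn : 2 ≤ n)
    (hA : ∀ k x, A k (x + 1) = A k x + 1) (hper : ∀ k, A (k + n) = A k)
    {S : ℤ → Prop} (hS : ∀ k, S (k + n) ↔ S k) (hS' : ∀ k, S k → ¬ S (k + 1))
    (h1 : ∀ k, S k → A' k = A (k + 1))
    (h2 : ∀ k, S (k - 1) → A' k = (A k)⁻¹ * A (k - 1) * A k)
    (h3 : ∀ k, ¬ S k → ¬ S (k - 1) → A' k = A k) :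
    ∃ p' d', IsMarking n A' p' d' := by
  classical
  have hS0 : ∀ k, S (k - 1) → ¬ S k := fun k hk => by simpa using hS' _ hk
  have hAi := fun k => orderIso_inv_add_one (hA k)
  have ip : ∀ k, (A k)⁻¹ (p k) = p k := fun k => by
    apply (A k).injective; rw [RelIso.apply_inv_self, h.map_p]
  have id' : ∀ k, (A k)⁻¹ (d (k - 1) + 1) = d k := fun k => by
    apply (A k).injective; rw [RelIso.apply_inv_self, h.map_d]
  have key1 : ∀ k, p (k + 1) < (A (k + 1))⁻¹ (d (k - 1) + 1) := by
    intro k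
    have h5 : p (k + 1) < d (k - 1) + 1 := by
      rw [← h.d_add]
      refine lt_of_le_of_lt ?_ (h.p_lt_d _)
      exact h.p_strictMono.monotone (by omega)
    have := (A (k + 1))⁻¹.strictMono h5
    rwa [ip] at this
  have key2 : ∀ k, (A k)⁻¹ (p (k - 1) + 1) < d k := by
    intro k
    have h5 : p (k - 1) + 1 < d (k - 1) + 1 := by have := h.p_lt_d (k - 1); linarith
    have := (A k)⁻¹.strictMono h5
    rwa [id'] at this
  let p' : ℤ → ℝ := fun k =>
    if S k then p (k + 1) else if S (k - 1) then (A k)⁻¹ (p (k - 1) + 1) else p k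
  let d' : ℤ → ℝ := fun k => if S k then (A (k + 1))⁻¹ (d (k - 1) + 1) else d k
  have p1 : ∀ k, S k → p' k = p (k + 1) := fun k hk => by simp [p', hk]
  have p2 : ∀ k, S (k - 1) → p' k = (A k)⁻¹ (p (k - 1) + 1) :=
    fun k hk => by simp [p', hk, hS0 k hk]
  have p3 : ∀ k, ¬ S k → ¬ S (k - 1) → p' k = p k := fun k hk hk' => by simp [p', hk, hk']
  have d1 : ∀ k, S k → d' k = (A (k + 1))⁻¹ (d (k - 1) + 1) := fun k hk => by simp [d', hk]
  have d2 : ∀ k, ¬ S k → d' k = d k := fun k hk => by simp [d', hk]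
  refine ⟨p', d', ?_, ?_, ?_, ?_, ?_, ?_⟩
  · intro k
    by_cases hk : S k
    · rw [p1 k hk, d1 k hk]; exact key1 k
    by_cases hk' : S (k - 1)
    · rw [p2 k hk', d2 k hk]; exact key2 k
    · rw [p3 k hk hk', d2 k hk]; exact h.p_lt_d k
  · intro k
    by_cases hk : S k
    · rw [d1 k hk, p2 (k + 1) (by simpa using hk), add_sub_cancel_right]
      apply (A (k + 1))⁻¹.strictMono
      have := h.d_lt_p (k - 1)
      rw [sub_add_cancel] at this
      linarith
    rw [d2 k hk]
    by_cases hk' : S (k + 1)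
    · rw [p1 _ hk']; exact (h.d_lt_p k).trans (h.p_strictMono (by omega))
    · rw [p3 _ hk' (by simpa using hk)]; exact h.d_lt_p k
  · intro k
    have e1 : k + (n : ℤ) + 1 = k + 1 + n := by ring
    have e2 : k + (n : ℤ) - 1 = k - 1 + n := by ring
    simp only [p', hS, e1, e2, h.p_add, hper, hAi]
    split_ifs <;> ring
  · intro k
    have e1 : k + (n : ℤ) + 1 = k + 1 + n := by ring
    have e2 : k + (n : ℤ) - 1 = k - 1 + n := by ring
    simp only [d', hS, e1, e2, h.d_add, hper, hAi]
    split_ifs <;> ring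
  · intro k
    by_cases hk : S k
    · rw [p1 k hk, h1 k hk, h.map_p]
    by_cases hk' : S (k - 1)
    · rw [p2 k hk', h2 k hk', RelIso.mul_apply, RelIso.mul_apply, RelIso.apply_inv_self, hA,
        h.map_p]
    · rw [p3 k hk hk', h3 k hk hk', h.map_p]
  · intro k
    by_cases hk : S k
    · have hk' : ¬ S (k - 1) := fun h' => hS0 k h' hk
      rw [d1 k hk, d2 _ hk', h1 k hk, RelIso.apply_inv_self]
    by_cases hk' : S (k - 1)
    · rw [d2 k hk, d1 _ hk', h2 k hk', RelIso.mul_apply, RelIso.mul_apply, h.map_d, hA, h.map_d,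
        hAi, sub_add_cancel]
    · rw [d2 k hk, d2 _ hk', h3 k hk hk', h.map_d]

/-- The residue of an integer modulo `n`, as an index. -/
def residue (hn : 2 ≤ n) (k : ℤ) : Fin n :=
  ⟨(k % n).toNat, by have := Int.emod_lt_of_pos k (by omega : (0 : ℤ) < n); omega⟩

variable (hn : 2 ≤ n)

theorem residue_add_self (k : ℤ) : residue hn (k + n) = residue hn k := by
  simp [residue]

theorem residue_add_one (k : ℤ) : residue hn (k + 1) = cycSucc (residue hn k) := by
  have h0 : (0 : ℤ) < n := by omega
  have h1 := Int.emod_nonneg k h0.ne'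
  have h3 := Int.emod_nonneg (k + 1) h0.ne'
  ext
  simp only [residue, cycSucc]
  zify
  rw [Int.toNat_of_nonneg h1, Int.toNat_of_nonneg h3]
  simp

theorem residue_natCast (j : Fin n) : residue hn (j.1 : ℤ) = j := by
  ext
  simp only [residue]
  rw [← Int.natCast_mod, Int.toNat_natCast, Nat.mod_eq_of_lt j.2]

theorem residue_eq_succ_iff (k : ℤ) (i : Fin n) :
    residue hn k = cycSucc i ↔ residue hn (k - 1) = i := by
  have := residue_add_one hn (k - 1)
  rw [sub_add_cancel] at this
  rw [this]
  exact cycSucc_injective.eq_iff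

variable {α : FreeGroup (Fin n) →* (ℝ ≃o ℝ)}

theorem IsPolygonAction.exists_isMarking_one (hα : IsPolygonAction n α) :
    IsMarking n (fun k => α (of (residue hn k))) (fun k => (k : ℝ) / n)
      (fun k => (k : ℝ) / n + 1 / (2 * n)) := by
  have hn' : (0 : ℝ) < n := by have : 0 < n := by omega
                               exact_mod_cast this
  have hk : ∀ k : ℤ, ∃ m : ℤ, (k : ℝ) / n = ((residue hn k : Fin n) : ℝ) / n + m := by
    intro k
    refine ⟨k / n, ?_⟩
    have h1 := Int.emod_nonneg k (by omega : (n : ℤ) ≠ 0)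
    have h2 : (((residue hn k : Fin n) : ℕ) : ℤ) = k % n := Int.toNat_of_nonneg h1
    have h3 := Int.emod_add_mul_ediv k n
    rw [← h2] at h3
    have h4 : (((residue hn k : Fin n) : ℕ) : ℝ) + n * ((k / n : ℤ) : ℝ) = k := by
      exact_mod_cast h3
    rw [← h4]; field_simp
  refine ⟨?_, ?_, ?_, ?_, ?_, ?_⟩
  · intro k; have : (0 : ℝ) < 1 / (2 * n) := by positivity
    simpa using hn'
  · intro k
    push_cast
    rw [add_div, add_lt_add_iff_left, div_lt_div_iff₀ (by positivity) hn']
    linarith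
  · intro k; push_cast; field_simp
  · intro k; push_cast; field_simp; ring
  · intro k
    obtain ⟨m, hm⟩ := hk k
    rw [hm, orderIso_add_int (hα.add_one _), hα.vertex]
  · intro k
    obtain ⟨m, hm⟩ := hk k
    have e : ((k - 1 : ℤ) : ℝ) / n + 1 / (2 * n) = (k : ℝ) / n - 1 / (2 * n) := by
      push_cast; field_simp; ring
    rw [e, hm, add_right_comm, orderIso_add_int (hα.add_one _), hα.side]
    ring

theorem IsPolygonAction.exists_isMarking (hα : IsPolygonAction n α) (g : AffineBraidGroup n) :
    ∃ p d, IsMarking n (fun k => α (rhoAff hn g (of (residue hn k)))) p d := by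
  induction g using affineBraid_induction with
  | one => rw [map_one]; exact ⟨_, _, hα.exists_isMarking_one hn⟩
  | mul g i e ih =>
    obtain ⟨p, d, h⟩ := ih
    rw [map_mul, rhoAff_signedGen]
    have hA : ∀ (k : ℤ) x, α (rhoAff hn g (of (residue hn k))) (x + 1) =
      α (rhoAff hn g (of (residue hn k))) x + 1 := fun k x => hα.add_one _ x
    have hper : ∀ k : ℤ, α (rhoAff hn g (of (residue hn (k + n)))) =
        α (rhoAff hn g (of (residue hn k))) := fun k => by rw [residue_add_self]
    have hS : ∀ k : ℤ, residue hn (k + n) = i ↔ residue hn k = i :=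
      fun k => by rw [residue_add_self]
    have hS' : ∀ k : ℤ, residue hn k = i → ¬ residue hn (k + 1) = i := by
      intro k hk; rw [residue_add_one, hk]; exact (ne_cycSucc hn i).symm
    cases e with
    | true =>
      refine h.exists_mul_sigma hn hA hper (S := fun k => residue hn k = i) hS hS' ?_ ?_ ?_
      · intro k hk
        rw [residue_add_one, hk, MulAut.mul_apply, sigmaSigned_true, sigmaAut_self]
        simp
      · intro k hk
        rw [hk, (residue_eq_succ_iff hn k i).2 hk, MulAut.mul_apply, sigmaSigned_true,
          sigmaAut_succ]
      · intro k hk hk'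
        rw [MulAut.mul_apply, sigmaSigned_true,
          sigmaAut_of_ne hn hk (fun h' => hk' ((residue_eq_succ_iff hn k i).1 h'))]
    | false =>
      refine h.exists_mul_sigma_inv hn hA hper (S := fun k => residue hn k = i) hS hS' ?_ ?_ ?_
      · intro k hk
        rw [residue_add_one, hk, MulAut.mul_apply, sigmaSigned_false, sigmaAut_inv_self]
      · intro k hk
        rw [hk, (residue_eq_succ_iff hn k i).2 hk, MulAut.mul_apply, sigmaSigned_false,
          sigmaAut_inv_succ]
        simp
      · intro k hk hk'
        rw [MulAut.mul_apply, sigmaSigned_false,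
          sigmaAut_inv_of_ne hn hk (fun h' => hk' ((residue_eq_succ_iff hn k i).1 h'))]

/-- Two consecutive neighbours of a conjugate cannot wind around its end from both sides. -/
theorem not_isDescent_false_and_true {g : AffineBraidGroup n} {U : Fin n → List (Fin n × Bool)}
    {π : Equiv.Perm (Fin n)} (hU : IsTightForm (rhoAff hn g) U π) (i : Fin n)
    (h1 : IsDescent U π i false) (h2 : IsDescent U π (cycSucc i) true) : False := by
  obtain ⟨α, hα⟩ := exists_isPolygonAction hn
  obtain ⟨p, d, h⟩ := hα.exists_isMarking hn g
  obtain ⟨R₁, h1⟩ : U (cycSucc i) ++ [(π (cycSucc i), true)] <+: U i := h1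
  obtain ⟨R₂, h2⟩ : U (cycSucc i) ++ [(π (cycSucc i), false)] <+: U (cycSucc (cycSucc i)) := h2
  have hn' : (2 : ℝ) ≤ n := by exact_mod_cast hn
  have ht0 : (0 : ℝ) < 1 / (2 * n) := by positivity
  have ht1 : (1 : ℝ) / (2 * n) < 1 := by rw [div_lt_one (by positivity)]; linarith
  set k : ℤ := (i.1 : ℤ) + 1 with hk
  have r0 : residue hn (k - 1) = i := by rw [hk, add_sub_cancel_right, residue_natCast]
  have r1 : residue hn k = cycSucc i := (residue_eq_succ_iff hn k i).2 r0
  have r2 : residue hn (k + 1) = cycSucc (cycSucc i) := by rw [residue_add_one, r1]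
  set v := U (cycSucc i) with hv
  set y := π (cycSucc i) with hy
  -- Undoing the common beginning `v` places `p k` at a standard vertex and lets the next letter
  -- `x_y^{±1}` locate each of its neighbours in a sector.
  let β : ℝ ≃o ℝ := (α (FreeGroup.mk v))⁻¹
  have hβ1 : ∀ x, β (x + 1) = β x + 1 := orderIso_inv_add_one (hα.add_one _)
  -- the vertex of index `l`, seen from the end of the conjugator of index `l`
  have vertex : ∀ l, ∃ m : ℤ, p l =
      α (FreeGroup.mk (U (residue hn l))) ((π (residue hn l) : ℝ) / n + m) := by
    intro l
    have h4 := h.map_p l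
    rw [(hU _).2, map_mul, map_mul, map_inv, RelIso.mul_apply, RelIso.mul_apply] at h4
    obtain ⟨m, hm⟩ := hα.fixed _ _
      ((α (FreeGroup.mk (U (residue hn l)))).injective (h4.trans (RelIso.apply_inv_self _ _).symm))
    refine ⟨m, ?_⟩
    rw [← hm, RelIso.apply_inv_self]
  have hmkv : ∀ L x, β (α (FreeGroup.mk (v ++ L)) x) = α (FreeGroup.mk L) x := by
    intro L x
    rw [← mul_mk, map_mul, RelIso.mul_apply, RelIso.inv_apply_self]
  obtain ⟨m₁, hm₁⟩ := vertex k
  obtain ⟨m₀, hm₀⟩ := vertex (k - 1)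
  obtain ⟨m₂, hm₂⟩ := vertex (k + 1)
  rw [r1] at hm₁
  rw [r0, ← h1, List.append_assoc] at hm₀
  rw [r2, ← h2, List.append_assoc] at hm₂
  have q1 : β (p k) = (y : ℝ) / n + m₁ := by rw [hm₁, RelIso.inv_apply_self]
  have tight : ∀ b j R, IsTight (v ++ [(y, b)] ++ R) j → IsTight ((y, b) :: R) j := by
    intro b j R hT
    rw [List.append_assoc] at hT
    refine ⟨hT.1.infix (List.suffix_append v _).isInfix, ?_⟩
    have := hT.2
    rwa [List.getLast?_append_of_ne_nil _ (by simp)] at this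
  obtain ⟨M₀, hM₀, hM₀'⟩ := hα.inSector hn R₁ y true (π i) m₀ (tight _ _ _ (h1 ▸ (hU i).1))
  obtain ⟨M₂, hM₂, hM₂'⟩ := hα.inSector hn R₂ y false (π (cycSucc (cycSucc i))) m₂
    (tight _ _ _ (h2 ▸ (hU (cycSucc (cycSucc i))).1))
  have q0 := congrArg β hm₀
  have q2 := congrArg β hm₂
  rw [hmkv] at q0 q2
  rw [show (y, true) :: R₁ = [(y, true)] ++ R₁ from rfl, ← q0] at hM₀ hM₀'
  rw [show (y, false) :: R₂ = [(y, false)] ++ R₂ from rfl, ← q2] at hM₂ hM₂'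
  have o1 := β.strictMono (h.p_strictMono (by omega : k - 1 < k))
  have o2 := β.strictMono (h.p_strictMono (by omega : k < k + 1))
  -- Consecutive vertices are less than one period apart, so both neighbours lie in the sectors at
  -- the same translate of the vertex `y`.
  have o3 := β.strictMono (h.p_strictMono (by omega : k < k - 1 + n))
  have o4 := β.strictMono (h.p_strictMono (by omega : k + 1 < k + n))
  rw [h.p_add, hβ1, q1] at o3 o4
  rw [q1] at o1 o2
  have e0 : M₀ = m₁ := by
    have a1 : (M₀ : ℝ) < m₁ + 1 := by linarith
    have a2 : (m₁ : ℝ) < M₀ + 1 := by linarith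
    have a1' : M₀ < m₁ + 1 := by exact_mod_cast a1
    have a2' : m₁ < M₀ + 1 := by exact_mod_cast a2
    omega
  have e2 : M₂ = m₁ := by
    have a1 : (M₂ : ℝ) < m₁ + 1 := by linarith
    have a2 : (m₁ : ℝ) < M₂ + 1 := by linarith
    have a1' : M₂ < m₁ + 1 := by exact_mod_cast a1
    have a2' : m₁ < M₂ + 1 := by exact_mod_cast a2
    omega
  rw [e0] at hM₀
  rw [e2] at hM₂'
  have o5 := β.strictMono (h.d_lt_p k)
  have o6 := β.strictMono (h.p_lt_d (k - 1))
  have hd : α (of y) (β (d k)) = β (d (k - 1)) + 1 := by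
    have h4 := h.map_d k
    rw [r1, (hU _).2, map_mul, map_mul, map_inv, RelIso.mul_apply, RelIso.mul_apply] at h4
    rw [← hβ1, ← h4]
    exact (RelIso.inv_apply_self _ _).symm
  -- The side pairing sends `d k` to `d (k-1) + 1`. Since `d k` lies before the outer end of the
  -- right sector, `d (k-1)` must lie before the outer end of the left one; but it exceeds `p
  -- (k-1)`, which is inside.
  have o7 := (α (of y)).strictMono (o5.trans hM₂')
  rw [hd, orderIso_add_int (hα.add_one _), hα.side] at o7
  linarith

end Marking

end AffineBraid

namespace AffineBraid

open FreeGroup hiding map_mul map_inv map_one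

/-! ### Braid relations below a given height -/

section Confluence

variable {n : ℕ} (hn : 2 ≤ n)

theorem of_braid (h3 : 3 ≤ n) (i : Fin n) :
    (PresentedGroup.of i * PresentedGroup.of (cycSucc i) * PresentedGroup.of i :
      AffineBraidGroup n) =
      PresentedGroup.of (cycSucc i) * PresentedGroup.of i * PresentedGroup.of (cycSucc i) := by
  rw [← mul_inv_eq_one]
  exact PresentedGroup.one_of_mem (AffineBraidRelator.braid h3 i)

theorem signedGen_comm {i j : Fin n} (hij : i ≠ j) (h1 : j ≠ cycSucc i) (h2 : i ≠ cycSucc j)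
    (e f : Bool) : (signedGen i e * signedGen j f : AffineBraidGroup n) =
      signedGen j f * signedGen i e := by
  have h : Commute (PresentedGroup.of i : AffineBraidGroup n) (PresentedGroup.of j) := by
    rw [commute_iff_eq, ← mul_inv_eq_one]
    exact PresentedGroup.one_of_mem (AffineBraidRelator.comm i j hij h1 h2)
  cases e <;> cases f
  · exact h.inv_inv
  · exact h.inv_left
  · exact h.inv_right
  · exact h

/-- The length of the automorphism assigned to an element of the affine braid group. -/
def height (g : AffineBraidGroup n) : ℕ := totalLength (rhoAff hn g)

/-- Adjacency in the Cayley graph, between elements of height less than `N`. -/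
def AdjBelow (N : ℕ) (g h : AffineBraidGroup n) : Prop :=
  (∃ i e, h = g * signedGen i e) ∧ height hn g < N ∧ height hn h < N

theorem signedGen_mul_signedGen_not (g : AffineBraidGroup n) (i : Fin n) (e : Bool) :
    g * signedGen i e * signedGen i (!e) = g := by
  cases e <;> simp [signedGen]

theorem AdjBelow.symm {N : ℕ} {g h : AffineBraidGroup n} (H : AdjBelow hn N g h) :
    AdjBelow hn N h g := by
  obtain ⟨⟨i, e, rfl⟩, h1, h2⟩ := H
  exact ⟨⟨i, !e, (signedGen_mul_signedGen_not g i e).symm⟩, h2, h1⟩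

/-- Being joined by a path of elements of height less than `N`. -/
def JoinedBelow (N : ℕ) : AffineBraidGroup n → AffineBraidGroup n → Prop :=
  Relation.ReflTransGen (AdjBelow hn N)

theorem JoinedBelow.symm {N : ℕ} {g h : AffineBraidGroup n} (H : JoinedBelow hn N g h) :
    JoinedBelow hn N h g := by
  induction H with
  | refl => exact .refl
  | tail _ h ih => exact .head (h.symm hn) ih

/-- A relation between two words of three letters is a hexagon at `g`; the path goes round the five
vertices other than `g`. -/
theorem joinedBelow_of_hexagon {N : ℕ} {g : AffineBraidGroup n} {i₁ i₂ i₃ j₁ j₂ j₃ : Fin n}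
    {a₁ a₂ a₃ b₁ b₂ b₃ : Bool}
    (hrel : (signedGen i₁ a₁ * signedGen i₂ a₂ * signedGen i₃ a₃ : AffineBraidGroup n) =
      signedGen j₁ b₁ * signedGen j₂ b₂ * signedGen j₃ b₃)
    (h1 : height hn (g * signedGen i₁ a₁) < N)
    (h2 : height hn (g * signedGen i₁ a₁ * signedGen i₂ a₂) < N)
    (h3 : height hn (g * signedGen i₁ a₁ * signedGen i₂ a₂ * signedGen i₃ a₃) < N)
    (h4 : height hn (g * signedGen j₁ b₁ * signedGen j₂ b₂) < N)
    (h5 : height hn (g * signedGen j₁ b₁) < N) :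
    JoinedBelow hn N (g * signedGen i₁ a₁) (g * signedGen j₁ b₁) := by
  have e : g * signedGen i₁ a₁ * signedGen i₂ a₂ * signedGen i₃ a₃ =
      g * signedGen j₁ b₁ * signedGen j₂ b₂ * signedGen j₃ b₃ := by
    simp only [mul_assoc] at hrel ⊢
    rw [hrel]
  have t1 : AdjBelow hn N _ _ := ⟨⟨i₂, a₂, rfl⟩, h1, h2⟩
  have t2 : AdjBelow hn N _ _ := ⟨⟨i₃, a₃, rfl⟩, h2, h3⟩
  have t3 : AdjBelow hn N _ _ := ⟨⟨j₃, b₃, rfl⟩, h4, e ▸ h3⟩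
  have t4 : AdjBelow hn N _ _ := ⟨⟨j₂, b₂, rfl⟩, h5, h4⟩
  rw [← e] at t3
  exact ((((Relation.ReflTransGen.single t1).tail t2).tail (t3.symm hn)).tail (t4.symm hn))

theorem height_mul (g : AffineBraidGroup n) (i : Fin n) (e : Bool) :
    height hn (g * signedGen i e) = totalLength (rhoAff hn g * sigmaSigned hn i e) := by
  rw [height, map_mul, rhoAff_signedGen]

theorem rho_true (g : AffineBraidGroup n) (i : Fin n) :
    rhoAff hn (g * signedGen i true) = rhoAff hn g * sigmaAut hn i := by
  rw [map_mul, rhoAff_signedGen]; rfl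

theorem rho_false (g : AffineBraidGroup n) (i : Fin n) :
    rhoAff hn (g * signedGen i false) = rhoAff hn g * (sigmaAut hn i)⁻¹ := by
  rw [map_mul, rhoAff_signedGen]; rfl

theorem height_true {g : AffineBraidGroup n} {i : Fin n} {A B : FreeGroup (Fin n)}
    (hA : rhoAff hn g (of i) = A) (hB : rhoAff hn g (of (cycSucc i)) = B) :
    height hn (g * signedGen i true) + norm B = height hn g + norm (A * B * A⁻¹) := by
  subst hA hB
  rw [height, rho_true]
  exact totalLength_mul_sigmaAut hn _ i

theorem height_false {g : AffineBraidGroup n} {i : Fin n} {A B : FreeGroup (Fin n)}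
    (hA : rhoAff hn g (of i) = A) (hB : rhoAff hn g (of (cycSucc i)) = B) :
    height hn (g * signedGen i false) + norm A = height hn g + norm (B⁻¹ * A * B) := by
  subst hA hB
  rw [height, rho_false]
  exact totalLength_mul_sigmaAut_inv hn _ i

/-- The values of `ρ(g)` on three consecutive generators. -/
def Values (g : AffineBraidGroup n) (i : Fin n) (A B C : FreeGroup (Fin n)) : Prop :=
  rhoAff hn g (of i) = A ∧ rhoAff hn g (of (cycSucc i)) = B ∧
    rhoAff hn g (of (cycSucc (cycSucc i))) = C

variable {g : AffineBraidGroup n} {i : Fin n} {A B C : FreeGroup (Fin n)}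

theorem Values.fst_true (h3 : 3 ≤ n) (h : Values hn g i A B C) :
    Values hn (g * signedGen i true) i (A * B * A⁻¹) A C ∧
      height hn (g * signedGen i true) + norm B = height hn g + norm (A * B * A⁻¹) := by
  refine ⟨?_, height_true hn h.1 h.2.1⟩
  obtain ⟨rfl, rfl, rfl⟩ := h
  refine ⟨?_, ?_, ?_⟩ <;> rw [rho_true, MulAut.mul_apply]
  · rw [sigmaAut_self]; simp
  · rw [sigmaAut_succ]
  · rw [sigmaAut_of_ne hn (ne_cycSucc_cycSucc h3 i).symm (ne_cycSucc hn _).symm]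

theorem Values.fst_false (h3 : 3 ≤ n) (h : Values hn g i A B C) :
    Values hn (g * signedGen i false) i B (B⁻¹ * A * B) C ∧
      height hn (g * signedGen i false) + norm A = height hn g + norm (B⁻¹ * A * B) := by
  refine ⟨?_, height_false hn h.1 h.2.1⟩
  obtain ⟨rfl, rfl, rfl⟩ := h
  refine ⟨?_, ?_, ?_⟩ <;> rw [rho_false, MulAut.mul_apply]
  · rw [sigmaAut_inv_self]
  · rw [sigmaAut_inv_succ]; simp
  · rw [sigmaAut_inv_of_ne hn (ne_cycSucc_cycSucc h3 i).symm (ne_cycSucc hn _).symm]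

theorem Values.snd_true (h3 : 3 ≤ n) (h : Values hn g i A B C) :
    Values hn (g * signedGen (cycSucc i) true) i A (B * C * B⁻¹) B ∧
      height hn (g * signedGen (cycSucc i) true) + norm C =
        height hn g + norm (B * C * B⁻¹) := by
  refine ⟨?_, height_true hn h.2.1 h.2.2⟩
  obtain ⟨rfl, rfl, rfl⟩ := h
  refine ⟨?_, ?_, ?_⟩ <;> rw [rho_true, MulAut.mul_apply]
  · rw [sigmaAut_of_ne hn (ne_cycSucc hn _) (ne_cycSucc_cycSucc h3 i)]
  · rw [sigmaAut_self]; simp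
  · rw [sigmaAut_succ]

theorem Values.snd_false (h3 : 3 ≤ n) (h : Values hn g i A B C) :
    Values hn (g * signedGen (cycSucc i) false) i A C (C⁻¹ * B * C) ∧
      height hn (g * signedGen (cycSucc i) false) + norm B =
        height hn g + norm (C⁻¹ * B * C) := by
  refine ⟨?_, height_false hn h.2.1 h.2.2⟩
  obtain ⟨rfl, rfl, rfl⟩ := h
  refine ⟨?_, ?_, ?_⟩ <;> rw [rho_false, MulAut.mul_apply]
  · rw [sigmaAut_inv_of_ne hn (ne_cycSucc hn _) (ne_cycSucc_cycSucc h3 i)]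
  · rw [sigmaAut_inv_self]
  · rw [sigmaAut_inv_succ]; simp

/-- The conjugate of the generator `y` by the word `U`. -/
def conjOf (U : List (Fin n × Bool)) (y : Fin n) : FreeGroup (Fin n) :=
  FreeGroup.mk U * of y * (FreeGroup.mk U)⁻¹

theorem conjOf_mul (U R : List (Fin n × Bool)) (x y : Fin n) :
    conjOf U x * conjOf (U ++ (x, false) :: R) y * (conjOf U x)⁻¹ = conjOf (U ++ R) y := by
  have h := conj_cancel_eq U R x y true
  rwa [mk_true] at h

theorem conjOf_inv_mul (U R : List (Fin n × Bool)) (x y : Fin n) :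
    (conjOf U x)⁻¹ * conjOf (U ++ (x, true) :: R) y * conjOf U x = conjOf (U ++ R) y := by
  have h := conj_cancel_eq U R x y false
  rwa [← inv_conj, inv_inv] at h

theorem norm_conjOf_lt {U V : List (Fin n × Bool)} {y : Fin n} (hV : IsTight V y)
    (h : U.length < V.length) : norm (conjOf U y) < norm (conjOf V y) := by
  have h1 := norm_conj_le U y
  have h2 := hV.norm_conj
  unfold conjOf
  omega

variable {U V W : List (Fin n × Bool)} {x y z : Fin n}

/-- The prefixes nest as `V = U x⁻¹ R` and `W = U x⁻¹ R y⁻¹ S`, so each step along either side of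
the braid relation cancels a letter and lowers the height. -/
theorem joinedBelow_true_true (h3 : 3 ≤ n) (hV : IsTight V y) (hW : IsTight W z)
    (h : Values hn g i (conjOf U x) (conjOf V y) (conjOf W z))
    (h1 : U ++ [(x, false)] <+: V) (h2 : V ++ [(y, false)] <+: W) :
    JoinedBelow hn (height hn g) (g * signedGen i true) (g * signedGen (cycSucc i) true) := by
  obtain ⟨R, rfl⟩ := h1
  obtain ⟨S, rfl⟩ := h2
  simp only [List.append_assoc, List.nil_append, List.cons_append] at h hV hW
  obtain ⟨v1, l1⟩ := h.fst_true hn h3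
  obtain ⟨v2, l2⟩ := v1.snd_true hn h3
  obtain ⟨v3, l3⟩ := v2.fst_true hn h3
  obtain ⟨w1, k1⟩ := h.snd_true hn h3
  obtain ⟨w2, k2⟩ := w1.fst_true hn h3
  have e1 := conjOf_mul (U ++ (x, false) :: R) S y z
  simp only [List.append_assoc, List.cons_append] at e1
  have e2 := conjOf_mul U (R ++ S) x z
  rw [conjOf_mul] at l1 l3
  rw [conjOf_mul] at l2 l3
  rw [e1] at k1 k2
  rw [e2] at k2
  have e3 := conjOf_mul (U ++ R) S y z
  simp only [List.append_assoc] at e3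
  rw [e3] at l3
  have n1 := norm_conjOf_lt (U := U ++ R) hV (by simp)
  have n2 := norm_conjOf_lt (U := U ++ (R ++ (y, false) :: S)) hW (by simp)
  have n3 := norm_conjOf_lt (U := U ++ (R ++ S)) hW (by simp)
  have n4 := norm_conjOf_lt (U := U ++ (x, false) :: (R ++ S)) hW (by simp)
  refine joinedBelow_of_hexagon hn (i₂ := cycSucc i) (i₃ := i) (j₂ := i) (j₃ := cycSucc i)
    (a₂ := true) (a₃ := true) (b₂ := true) (b₃ := true) (of_braid h3 i) ?_ ?_ ?_ ?_ ?_
  all_goals omega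

theorem joinedBelow_false_false (h3 : 3 ≤ n) (hU : IsTight U x) (hV : IsTight V y)
    (h : Values hn g i (conjOf U x) (conjOf V y) (conjOf W z))
    (h1 : V ++ [(y, true)] <+: U) (h2 : W ++ [(z, true)] <+: V) :
    JoinedBelow hn (height hn g) (g * signedGen i false) (g * signedGen (cycSucc i) false) := by
  obtain ⟨S, rfl⟩ := h2
  obtain ⟨R, rfl⟩ := h1
  simp only [List.append_assoc, List.nil_append, List.cons_append] at h hU hV
  obtain ⟨v1, l1⟩ := h.fst_false hn h3
  obtain ⟨v2, l2⟩ := v1.snd_false hn h3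
  obtain ⟨v3, l3⟩ := v2.fst_false hn h3
  obtain ⟨w1, k1⟩ := h.snd_false hn h3
  obtain ⟨w2, k2⟩ := w1.fst_false hn h3
  have e1 := conjOf_inv_mul (W ++ (z, true) :: S) R y x
  simp only [List.append_assoc, List.cons_append] at e1
  rw [e1] at l1 l2
  rw [conjOf_inv_mul] at l2 l3 k1 k2
  have n1 := norm_conjOf_lt (U := W ++ (z, true) :: (S ++ R)) hU (by simp)
  have n2 := norm_conjOf_lt (U := W ++ (S ++ R)) hU (by simp)
  have n3 := norm_conjOf_lt (U := W ++ S) hV (by simp)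
  have n4 := norm_conjOf_lt (U := W ++ (S ++ (y, true) :: R)) hU (by simp)
  have hrel : (signedGen i false * signedGen (cycSucc i) false * signedGen i false :
      AffineBraidGroup n) =
      signedGen (cycSucc i) false * signedGen i false * signedGen (cycSucc i) false := by
    have := congrArg (·⁻¹) (of_braid h3 i)
    simpa [signedGen, mul_assoc] using this
  refine joinedBelow_of_hexagon hn hrel ?_ ?_ ?_ ?_ ?_
  all_goals omega

/-- Both `U x⁻¹` and `W z` begin `V`, so they are comparable, and they differ because their last
letters have opposite signs. Which one is shorter decides the form of the braid relation whose
hexagon stays below `g`. -/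
theorem joinedBelow_true_false (h3 : 3 ≤ n) (hU : IsTight U x) (hV : IsTight V y)
    (hW : IsTight W z) (h : Values hn g i (conjOf U x) (conjOf V y) (conjOf W z))
    (h1 : U ++ [(x, false)] <+: V) (h2 : W ++ [(z, true)] <+: V) :
    JoinedBelow hn (height hn g) (g * signedGen i true) (g * signedGen (cycSucc i) false) := by
  have hb := of_braid h3 i
  obtain ⟨v1, l1⟩ := h.fst_true hn h3
  obtain ⟨w1, k1⟩ := h.snd_false hn h3
  obtain ⟨w2, k2⟩ := w1.fst_true hn h3
  have hor : U ++ [(x, false)] <+: W ∨ W ++ [(z, true)] <+: U := by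
    rcases List.prefix_or_prefix_of_prefix h1 h2 with h4 | h4
    · rcases List.prefix_concat_iff.1 h4 with h5 | h5
      · have := (List.append_inj' h5 rfl).2
        simp at this
      · exact Or.inl h5
    · rcases List.prefix_concat_iff.1 h4 with h5 | h5
      · have := (List.append_inj' h5 rfl).2
        simp at this
      · exact Or.inr h5
  rcases hor with h4 | h4
  · obtain ⟨S, rfl⟩ := h2
    obtain ⟨P, rfl⟩ := h4
    simp only [List.append_assoc, List.nil_append, List.cons_append] at *
    obtain ⟨v2, l2⟩ := v1.snd_true hn h3
    obtain ⟨v3, l3⟩ := v2.fst_false hn h3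
    have e1 := conjOf_inv_mul (U ++ (x, false) :: P) S z y
    simp only [List.append_assoc, List.cons_append] at e1
    have e2 := conjOf_inv_mul (U ++ P) S z y
    simp only [List.append_assoc] at e2
    rw [conjOf_mul] at l1 l2 l3 k2
    rw [conjOf_mul, e2] at l3
    rw [e1] at k1
    have n1 := norm_conjOf_lt (U := U ++ (P ++ (z, true) :: S)) hV (by simp)
    have n2 := norm_conjOf_lt (U := U ++ P) hW (by simp)
    have n3 := norm_conjOf_lt (U := U ++ (x, false) :: (P ++ S)) hV (by simp)
    have n4 := norm_conjOf_lt (U := U ++ (P ++ S)) hV (by simp)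
    have hrel : (signedGen i true * signedGen (cycSucc i) true * signedGen i false :
        AffineBraidGroup n) =
        signedGen (cycSucc i) false * signedGen i true * signedGen (cycSucc i) true := by
      simp only [signedGen, if_true, Bool.false_eq_true, if_false]
      rw [mul_inv_eq_iff_eq_mul, mul_assoc, mul_assoc, eq_inv_mul_iff_mul_eq]
      simpa only [mul_assoc] using hb.symm
    refine joinedBelow_of_hexagon hn hrel ?_ ?_ ?_ ?_ ?_
    all_goals omega
  · obtain ⟨S, rfl⟩ := h1
    obtain ⟨P, rfl⟩ := h4
    simp only [List.append_assoc, List.nil_append, List.cons_append] at *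
    obtain ⟨v2, l2⟩ := v1.snd_false hn h3
    obtain ⟨v3, l3⟩ := v2.fst_false hn h3
    obtain ⟨u2, m2⟩ := w1.fst_false hn h3
    have e1 := conjOf_mul (W ++ (z, true) :: P) S x y
    simp only [List.append_assoc, List.cons_append] at e1
    rw [e1] at l1 l3
    rw [conjOf_inv_mul] at l2 l3 k1 m2
    have n1 := norm_conjOf_lt (U := W ++ (z, true) :: (P ++ S)) hV (by simp)
    have n2 := norm_conjOf_lt (U := W ++ P) hU (by simp)
    have n3 := norm_conjOf_lt (U := W ++ (P ++ S)) hV (by simp)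
    have n4 := norm_conjOf_lt (U := W ++ (P ++ (x, false) :: S)) hV (by simp)
    have hrel : (signedGen i true * signedGen (cycSucc i) false * signedGen i false :
        AffineBraidGroup n) =
        signedGen (cycSucc i) false * signedGen i false * signedGen (cycSucc i) true := by
      simp only [signedGen, if_true, Bool.false_eq_true, if_false]
      rw [← mul_inv_rev, mul_assoc, ← mul_inv_rev, mul_inv_eq_iff_eq_mul, mul_assoc,
        eq_inv_mul_iff_mul_eq]
      simpa only [mul_assoc] using hb
    refine joinedBelow_of_hexagon hn hrel ?_ ?_ ?_ ?_ ?_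
    all_goals omega

end Confluence

end AffineBraid

namespace AffineBraid

open FreeGroup hiding map_mul map_inv map_one

/-! ### Uniqueness of the end of a descent, and faithfulness -/

section Faithful

variable {n : ℕ} (hn : 2 ≤ n)

theorem exists_isTightForm_rhoAff (g : AffineBraidGroup n) :
    ∃ U π, IsTightForm (rhoAff hn g) U π := by
  obtain ⟨⟨w, π, hw⟩, -⟩ := isAffineBraidLike_rhoAff hn g
  obtain ⟨U, hU⟩ := exists_isTightForm hw
  exact ⟨U, π, hU⟩

theorem height_mul_lt_iff {g : AffineBraidGroup n} {U : Fin n → List (Fin n × Bool)}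
    {π : Equiv.Perm (Fin n)} (hU : IsTightForm (rhoAff hn g) U π) (i : Fin n) (e : Bool) :
    height hn (g * signedGen i e) < height hn g ↔ IsDescent U π i e := by
  rw [height_mul, height]
  refine ⟨fun h => ?_, hU.totalLength_lt hn⟩
  by_contra hd
  exact absurd h (hU.lt_totalLength hn hd).not_gt

theorem height_mul_ne (g : AffineBraidGroup n) (i : Fin n) (e : Bool) :
    height hn (g * signedGen i e) ≠ height hn g := by
  obtain ⟨U, π, hU⟩ := exists_isTightForm_rhoAff hn g
  rw [height_mul, height]
  by_cases hd : IsDescent U π i e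
  · exact (hU.totalLength_lt hn hd).ne
  · exact (hU.lt_totalLength hn hd).ne'

theorem sigmaSigned_of_ne {i j : Fin n} (e : Bool) (h1 : j ≠ i) (h2 : j ≠ cycSucc i) :
    sigmaSigned hn i e (of j) = of j := by
  cases e
  · exact sigmaAut_inv_of_ne hn h1 h2
  · exact sigmaAut_of_ne hn h1 h2

/-- Commuting generators act on disjoint pairs of images, so the second descent still lowers the
height after the first and the commutation square closes below `g`. -/
theorem joinedBelow_of_far {g : AffineBraidGroup n} {i j : Fin n} {e f : Bool} (hij : i ≠ j)
    (h1 : j ≠ cycSucc i) (h2 : i ≠ cycSucc j)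
    (hi : height hn (g * signedGen i e) < height hn g)
    (hj : height hn (g * signedGen j f) < height hn g) :
    JoinedBelow hn (height hn g) (g * signedGen i e) (g * signedGen j f) := by
  have h3 : cycSucc j ≠ cycSucc i := fun h => hij (cycSucc_injective h).symm
  have v1 : rhoAff hn (g * signedGen i e) (of j) = rhoAff hn g (of j) := by
    rw [map_mul, MulAut.mul_apply, rhoAff_signedGen, sigmaSigned_of_ne hn e hij.symm h1]
  have v2 : rhoAff hn (g * signedGen i e) (of (cycSucc j)) = rhoAff hn g (of (cycSucc j)) := by
    rw [map_mul, MulAut.mul_apply, rhoAff_signedGen, sigmaSigned_of_ne hn e h2.symm h3]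
  have hlt : height hn (g * signedGen i e * signedGen j f) < height hn g := by
    cases f
    · have a1 := height_false hn v1 v2
      have a2 := height_false hn (g := g) (i := j) rfl rfl
      omega
    · have a1 := height_true hn v1 v2
      have a2 := height_true hn (g := g) (i := j) rfl rfl
      omega
  have t1 : AdjBelow hn (height hn g) _ _ := ⟨⟨j, f, rfl⟩, hi, hlt⟩
  have e1 : g * signedGen i e * signedGen j f = g * signedGen j f * signedGen i e := by
    rw [mul_assoc, signedGen_comm hij h1 h2, mul_assoc]
  have t2 : AdjBelow hn (height hn g) _ _ := ⟨⟨i, e, rfl⟩, hj, e1 ▸ hlt⟩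
  rw [← e1] at t2
  exact (Relation.ReflTransGen.single t1).tail (t2.symm hn)

theorem joinedBelow_of_adjacent {g : AffineBraidGroup n} {i : Fin n} {e f : Bool}
    (hi : height hn (g * signedGen i e) < height hn g)
    (hj : height hn (g * signedGen (cycSucc i) f) < height hn g) :
    JoinedBelow hn (height hn g) (g * signedGen i e) (g * signedGen (cycSucc i) f) := by
  obtain ⟨U, π, hU⟩ := exists_isTightForm_rhoAff hn g
  rw [height_mul_lt_iff hn hU] at hi hj
  rcases hn.lt_or_eq with h3 | h2
  · have hv : Values hn g i (conjOf (U i) (π i)) (conjOf (U (cycSucc i)) (π (cycSucc i)))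
        (conjOf (U (cycSucc (cycSucc i))) (π (cycSucc (cycSucc i)))) :=
      ⟨(hU _).2, (hU _).2, (hU _).2⟩
    cases e <;> cases f
    · exact joinedBelow_false_false hn h3 (hU _).1 (hU _).1 hv hi hj
    · exact (not_isDescent_false_and_true hn hU i hi hj).elim
    · exact joinedBelow_true_false hn h3 (hU _).1 (hU _).1 (hU _).1 hv hi hj
    · exact joinedBelow_true_true hn h3 (hU _).1 (hU _).1 hv hi hj
  -- For `n = 2` there is no relation to use, and no two such descents exist. With equal signs each
  -- conjugator would be longer than the other; with opposite signs one word would have two prefixes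
  -- of equal length ending in opposite letters.
  · exfalso
    have hs : cycSucc (cycSucc i) = i := by
      subst h2
      fin_cases i <;> rfl
    cases e <;> cases f <;> simp only [IsDescent, if_true, Bool.false_eq_true, if_false, hs] at hi hj
    · have := hi.length_le
      have := hj.length_le
      simp at *
      omega
    · have := List.prefix_of_prefix_length_le hi hj (by simp)
      rcases List.prefix_concat_iff.1 this with h5 | h5
      · simpa using (List.append_inj' h5 rfl).2
      · have := h5.length_le
        simp at this
    · have := List.prefix_of_prefix_length_le hi hj (by simp)
      rcases List.prefix_concat_iff.1 this with h5 | h5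
      · simpa using (List.append_inj' h5 rfl).2
      · have := h5.length_le
        simp at this
    · have := hi.length_le
      have := hj.length_le
      simp at *
      omega

theorem joinedBelow_of_descents {g : AffineBraidGroup n} {i j : Fin n} {e f : Bool}
    (hi : height hn (g * signedGen i e) < height hn g)
    (hj : height hn (g * signedGen j f) < height hn g) :
    JoinedBelow hn (height hn g) (g * signedGen i e) (g * signedGen j f) := by
  by_cases h1 : j = cycSucc i
  · subst h1; exact joinedBelow_of_adjacent hn hi hj
  by_cases h2 : i = cycSucc j
  · subst h2; exact (joinedBelow_of_adjacent hn hj hi).symm hn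
  by_cases hij : i = j
  · subst hij
    by_cases hef : e = f
    · subst hef; exact .refl
    · exfalso
      obtain ⟨U, π, hU⟩ := exists_isTightForm_rhoAff hn g
      rw [height_mul_lt_iff hn hU] at hi hj
      cases e <;> cases f <;>
        simp only [IsDescent, if_true, Bool.false_eq_true, if_false, not_true] at hi hj hef
      all_goals
        have := hi.length_le
        have := hj.length_le
        simp at *
        omega
  · exact joinedBelow_of_far hn hij h1 h2 hi hj

/-- Multiplication by a generator or its inverse that lowers the height. -/
def Lowers (g h : AffineBraidGroup n) : Prop :=
  (∃ i e, h = g * signedGen i e) ∧ height hn h < height hn g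

/-- `g` can be lowered step by step to the element `k` of the kernel. -/
def ReducesTo (g k : AffineBraidGroup n) : Prop :=
  Relation.ReflTransGen (Lowers hn) g k ∧ rhoAff hn k = 1

theorem Lowers.reducesTo {g h k : AffineBraidGroup n} (h1 : Lowers hn g h)
    (h2 : ReducesTo hn h k) : ReducesTo hn g k := ⟨.head h1 h2.1, h2.2⟩

theorem exists_reducesTo (g : AffineBraidGroup n) : ∃ k, ReducesTo hn g k := by
  induction hN : height hn g using Nat.strong_induction_on generalizing g with
  | _ N ih =>
    by_cases h1 : rhoAff hn g = 1
    · exact ⟨g, .refl, h1⟩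
    · obtain ⟨i, e, hlt⟩ := exists_isDescent hn (isAffineBraidLike_rhoAff hn g) h1
      rw [← height_mul, ← height] at hlt
      obtain ⟨k, hk⟩ := ih _ (hN ▸ hlt) _ rfl
      exact ⟨k, Lowers.reducesTo hn ⟨⟨i, e, rfl⟩, hlt⟩ hk⟩

theorem height_le_of_reflTransGen {g k : AffineBraidGroup n}
    (h : Relation.ReflTransGen (Lowers hn) g k) : height hn k ≤ height hn g := by
  induction h with
  | refl => exact le_rfl
  | tail _ h ih => exact h.2.le.trans ih

theorem ReducesTo.unique {g k k' : AffineBraidGroup n} (hk : ReducesTo hn g k)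
    (hk' : ReducesTo hn g k') : k = k' := by
  induction hN : height hn g using Nat.strong_induction_on generalizing g k k' with
  | _ N ih =>
    have hker : ∀ {a b : AffineBraidGroup n}, rhoAff hn a = 1 → rhoAff hn b = 1 →
        height hn a = height hn b := fun ha hb => by rw [height, height, ha, hb]
    -- Heights of adjacent elements differ, so along the path each edge is a lowering step one way
    -- or the other; by induction its two ends reduce to the same element.
    have path : ∀ {a b : AffineBraidGroup n}, JoinedBelow hn N a b → height hn a < N →
        ∀ {k k'}, ReducesTo hn a k → ReducesTo hn b k' → k = k' := by
      intro a b hab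
      induction hab with
      | refl => intro h0 k k' h1 h2; exact ih _ h0 h1 h2 rfl
      | @tail c d _ hcd ihc =>
        intro h0 k k' h1 h2
        obtain ⟨⟨i, e, rfl⟩, hc, hd⟩ := hcd
        obtain ⟨m, hm⟩ := exists_reducesTo hn c
        rw [ihc h0 h1 hm]
        rcases lt_or_gt_of_ne (height_mul_ne hn c i e) with hlt | hlt
        · exact ih _ hc hm (Lowers.reducesTo hn ⟨⟨i, e, rfl⟩, hlt⟩ h2) rfl
        · exact ih _ hd (Lowers.reducesTo hn
            ⟨⟨i, !e, (signedGen_mul_signedGen_not c i e).symm⟩, hlt⟩ hm) h2 rfl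
    rcases Relation.ReflTransGen.cases_head hk.1 with rfl | ⟨a, ha, hak⟩
    -- All kernel elements have the same height, so a descent from one of them cannot end in the
    -- kernel.
    · rcases Relation.ReflTransGen.cases_head hk'.1 with h | ⟨b, hb, hbk⟩
      · exact h
      · have := height_le_of_reflTransGen hn hbk
        have := hb.2
        have := hker hk.2 hk'.2
        omega
    · rcases Relation.ReflTransGen.cases_head hk'.1 with rfl | ⟨b, hb, hbk⟩
      · have := height_le_of_reflTransGen hn hak
        have := ha.2
        have := hker hk.2 hk'.2
        omega
      · obtain ⟨⟨i, e, rfl⟩, hi⟩ := ha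
        obtain ⟨⟨j, f, rfl⟩, hj⟩ := hb
        have hp := joinedBelow_of_descents hn hi hj
        rw [hN] at hp hi
        exact path hp hi ⟨hak, hk.2⟩ ⟨hbk, hk'.2⟩

/-- Induction on a word for `g`: appending a letter raises or lowers the height, and in either case
the end of the descent is unchanged. -/
theorem ReducesTo.eq_one {g : AffineBraidGroup n} :
    ∀ {k : AffineBraidGroup n}, ReducesTo hn g k → k = 1 := by
  induction g using affineBraid_induction with
  | one => intro k hk; exact hk.unique hn ⟨.refl, map_one _⟩
  | mul g i e ih =>
    intro k hk
    rcases lt_or_gt_of_ne (height_mul_ne hn g i e) with hlt | hlt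
    · exact ih (Lowers.reducesTo hn ⟨⟨i, e, rfl⟩, hlt⟩ hk)
    · obtain ⟨m, hm⟩ := exists_reducesTo hn g
      have h1 : Lowers hn (g * signedGen i e) g :=
        ⟨⟨i, !e, (signedGen_mul_signedGen_not g i e).symm⟩, hlt⟩
      rw [hk.unique hn (Lowers.reducesTo hn h1 hm), ih hm]

theorem rhoAff_injective : Function.Injective (rhoAff hn) := by
  rw [injective_iff_map_eq_one]
  intro g hg
  exact ReducesTo.eq_one hn (g := g) ⟨.refl, hg⟩

end Faithful

end AffineBraid

theorem theorem5p4 (n : ℕ) (hn : 2 ≤ n) :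
    Function.Injective (rhoAff hn) ∧
    ∀ φ : MulAut (FreeGroup (Fin n)),
      φ ∈ (rhoAff hn).range ↔
        (∃ (w : Fin n → FreeGroup (Fin n)) (π : Equiv.Perm (Fin n)),
          ∀ i : Fin n, φ (FreeGroup.of i) = w i * FreeGroup.of (π i) * (w i)⁻¹) ∧
        (∃ w : FreeGroup (Fin n), algLength w = 0 ∧
          φ (prodGenerators n) = w * prodGenerators n * w⁻¹) := by
  refine ⟨AffineBraid.rhoAff_injective hn, fun φ => ⟨?_, fun h => ?_⟩⟩
  · rintro ⟨g, rfl⟩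
    exact AffineBraid.isAffineBraidLike_rhoAff hn g
  · exact AffineBraid.IsAffineBraidLike.mem_range hn h
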